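/- Theorem (sub-$mn$ hardness of Eccentricities under SETH). Assume the Strong Exponential Time Hypothesis (SETH): for every real $\delta<1$ there is a $k$ such that no algorithm decides satisfiability of $k$-CNF formulas with $n$ variables (without repeated clauses, at most $k$ literals per clause) in $O(2^{\delta n})$ time. A function $g(m,n)$ is called sub-$mn$ if $g(m,n)=O(m^{\alpha}n^{\beta})$ for some real constants $\alpha,\beta$ with $\alpha+\beta<2$. In the Eccentricities problem one is given a simple graph $G$, with $n\ge 2$ vertices and $m$ edges, as a list of its edges, and has to compute $\max_{y\in V}d_G(x,y)$ for every vertex $x$, where $d_G(x,y)$ is the length (or weight) of a shortest path from $x$ to $y$. Then Eccentricities has no algorithm whose running time is bounded by a sub-$mn$ function $g(m,n)$, in any of the following four versions: (1) unweighted undirected graphs; (2) unweighted directed graphs; (3) undirected graphs with positive edge weights; (4) directed graphs with positive edge weights. In (1) and (3) this already holds for algorithms that only have to handle connected graphs, and in (2) and (4) for algorithms that only have to handle strongly connected graphs; in (3) and (4) it already holds, for every fixed $a\in\mathbb{N}$, for algorithms that only have to handle integer weights in $\{1,\dots,n^a\}$. Algorithms are deterministic random access machine programs (addition, truncated subtraction,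 multiplication, integer division, indirect addressing), and time is the logarithmic cost, i.e. each instruction is charged the bit length of the numbers it handles. A program is correct within a time bound if, on every input, it halts with the correct answer within that bound. -/

import Mathlib

/-! ### Random access machines with logarithmic cost

Programs are structured random access programs over the natural numbers, with finitely many named
registers and an unbounded, indirectly addressable memory. Time is the standard logarithmic cost:
every instruction is charged the total bit length of the numbers (addresses included) that it
handles. In particular there is no unit-cost arithmetic on long numbers. -/

namespace RAM

/-- The arithmetic instructions; `sub` is truncated subtraction, `div` is division with rounding
down (and `x / 0 = 0`). -/
inductive BinOp
  | add
  | sub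
  | mul
  | div

def BinOp.eval : BinOp → ℕ → ℕ → ℕ
  | .add, x, y => x + y
  | .sub, x, y => x - y
  | .mul, x, y => x * y
  | .div, x, y => x / y

/-- Programs. The natural-number arguments `d`, `a`, `b` are names of registers.
* `const d v`: register `d` receives the constant `v`;
* `bin op d a b`: register `d` receives `op` applied to the contents of registers `a` and `b`;
* `load d a`: register `d` receives the memory cell whose address is in register `a`;
* `store a b`: the memory cell whose address is in register `a` receives the content of `b`;
* `seq`, `ite`, `loop`: sequencing, branching on `register a ≠ 0`, and
  `while register a ≠ 0 do p`. -/
inductive Cmd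
  | skip
  | const (d v : ℕ)
  | bin (op : BinOp) (d a b : ℕ)
  | load (d a : ℕ)
  | store (a b : ℕ)
  | seq (p q : Cmd)
  | ite (a : ℕ) (p q : Cmd)
  | loop (a : ℕ) (p : Cmd)

/-- A configuration: the contents of the registers and of the memory. -/
@[ext]
structure State where
  reg : ℕ → ℕ
  mem : ℕ → ℕ

def State.setReg (s : State) (d v : ℕ) : State := { s with reg := Function.update s.reg d v }

def State.setMem (s : State) (i v : ℕ) : State := { s with mem := Function.update s.mem i v }

/-- The logarithmic cost of handling the number `x`: one plus the length of its binary expansion. -/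
def cost (x : ℕ) : ℕ := Nat.size x + 1

/-- `Exec p s t s'`: started in `s`, the program `p` halts in `s'` after time exactly `t`. -/
inductive Exec : Cmd → State → ℕ → State → Prop
  | skip (s) : Exec .skip s 1 s
  | const (s d v) : Exec (.const d v) s (cost v) (s.setReg d v)
  | bin (s op d a b) :
      Exec (.bin op d a b) s (cost (s.reg a) + cost (s.reg b))
        (s.setReg d (op.eval (s.reg a) (s.reg b)))
  | load (s d a) :
      Exec (.load d a) s (cost (s.reg a) + cost (s.mem (s.reg a))) (s.setReg d (s.mem (s.reg a)))
  | store (s a b) :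
      Exec (.store a b) s (cost (s.reg a) + cost (s.reg b)) (s.setMem (s.reg a) (s.reg b))
  | seq {p q s t s' t' s''} : Exec p s t s' → Exec q s' t' s'' → Exec (.seq p q) s (t + t') s''
  | ite_true {a p q s t s'} : s.reg a ≠ 0 → Exec p s t s' →
      Exec (.ite a p q) s (cost (s.reg a) + t) s'
  | ite_false {a p q s t s'} : s.reg a = 0 → Exec q s t s' →
      Exec (.ite a p q) s (cost (s.reg a) + t) s'
  | loop_exit {a p s} : s.reg a = 0 → Exec (.loop a p) s (cost (s.reg a)) s
  | loop_step {a p s t s' t' s''} : s.reg a ≠ 0 → Exec p s t s' → Exec (.loop a p) s' t' s'' →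
      Exec (.loop a p) s (cost (s.reg a) + t + t') s''

/-- The machine is deterministic: the running time and the final configuration are unique. -/
theorem Exec.unique {p : Cmd} {s s₁ : State} {t₁ : ℕ} (h₁ : Exec p s t₁ s₁) :
    ∀ {s₂ : State} {t₂ : ℕ}, Exec p s t₂ s₂ → t₁ = t₂ ∧ s₁ = s₂ := by
  induction h₁ with
  | skip | const | bin | load | store => intro _ _ h; cases h; exact ⟨rfl, rfl⟩
  | seq _ _ ih ih' =>
    intro _ _ h
    cases h with
    | seq h h' =>
      obtain ⟨rfl, rfl⟩ := ih h
      obtain ⟨rfl, rfl⟩ := ih' h'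
      exact ⟨rfl, rfl⟩
  | ite_true hz _ ih =>
    intro _ _ h
    cases h with
    | ite_true _ h => obtain ⟨rfl, rfl⟩ := ih h; exact ⟨rfl, rfl⟩
    | ite_false hz' _ => exact absurd hz' hz
  | ite_false hz _ ih =>
    intro _ _ h
    cases h with
    | ite_true hz' _ => exact absurd hz hz'
    | ite_false _ h => obtain ⟨rfl, rfl⟩ := ih h; exact ⟨rfl, rfl⟩
  | loop_exit hz =>
    intro _ _ h
    cases h with
    | loop_exit _ => exact ⟨rfl, rfl⟩
    | loop_step hz' _ _ => exact absurd hz hz'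
  | loop_step hz _ _ ih ih' =>
    intro _ _ h
    cases h with
    | loop_exit hz' => exact absurd hz' hz
    | loop_step _ h h' =>
      obtain ⟨rfl, rfl⟩ := ih h
      obtain ⟨rfl, rfl⟩ := ih' h'
      exact ⟨rfl, rfl⟩

/-- The initial configuration: the input stands in the memory cells `0, 1, 2, …`; all other cells
and all registers are `0`. -/
def init (input : List ℕ) : State where
  reg := fun _ => 0
  mem := fun i => input.getD i 0

/-- On every instance `x` the program `p` halts, within time `T x`, with a memory content that is a
correct answer for `x`. -/
def SolvesWithin {ι : Type} (p : Cmd) (encode : ι → List ℕ) (correct : ι → (ℕ → ℕ) → Prop)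
    (T : ι → ℝ) : Prop :=
  ∀ x : ι, ∃ (t : ℕ) (s : State), Exec p (init (encode x)) t s ∧ correct x s.mem ∧ (t : ℝ) ≤ T x

end RAM

/-! ### `k`-SAT and the Strong Exponential Time Hypothesis -/

/-- A literal over the variables `0, …, n - 1`: a variable and the truth value that satisfies it. -/
abbrev Literal (n : ℕ) : Type := Fin n × Bool

/-- A formula in conjunctive normal form with `n` variables, at most `k` literals in every clause,
and no repeated clause (so that for fixed `k` its length is polynomial in `n`). -/
structure KCNF (k : ℕ) where
  n : ℕ
  clauses : List (List (Literal n))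
  length_le : ∀ c ∈ clauses, c.length ≤ k
  nodup : clauses.Nodup

namespace KCNF

variable {k : ℕ}

def Satisfiable (φ : KCNF k) : Prop :=
  ∃ σ : Fin φ.n → Bool, ∀ c ∈ φ.clauses, ∃ l ∈ c, σ l.1 = l.2

/-- The literals `¬xᵢ` and `xᵢ` are written `2 i` and `2 i + 1`. -/
def encodeLiteral {n : ℕ} (l : Literal n) : ℕ := 2 * (l.1 : ℕ) + if l.2 then 1 else 0

/-- The number of variables, the number of clauses, and then the clauses one after the other, each
as its length followed by its literals. -/
def encode (φ : KCNF k) : List ℕ :=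
  φ.n :: φ.clauses.length :: φ.clauses.flatMap fun c => c.length :: c.map encodeLiteral

/-- The answer is a single bit in memory cell `0`. -/
def Correct (φ : KCNF k) (mem : ℕ → ℕ) : Prop :=
  (φ.Satisfiable → mem 0 = 1) ∧ (¬ φ.Satisfiable → mem 0 = 0)

end KCNF

/-- `k`-SAT can be solved in time `O(2 ^ (δ n))`, where `n` is the number of variables. -/
def KSatInTime (k : ℕ) (δ : ℝ) : Prop :=
  ∃ (p : RAM.Cmd) (C : ℝ),
    RAM.SolvesWithin p (KCNF.encode (k := k)) KCNF.Correct fun φ => C * (2 : ℝ) ^ (δ * φ.n)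

/-- The Strong Exponential Time Hypothesis. -/
def SETH : Prop := ∀ δ : ℝ, δ < 1 → ∃ k : ℕ, ¬ KSatInTime k δ

/-! ### Distances and eccentricities -/

section Distance

variable {V : Type*}

/-- `WalkOfWeight adj w u v d`: there is a walk from `u` to `v` of total weight `d` in the graph with
adjacency relation `adj` and edge weights `w`. -/
inductive WalkOfWeight (adj : V → V → Prop) (w : V → V → ℕ) : V → V → ℕ → Prop
  | nil (v : V) : WalkOfWeight adj w v v 0
  | cons {u v x : V} {d : ℕ} : adj u v → WalkOfWeight adj w v x d →
      WalkOfWeight adj w u x (w u v + d)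

/-- The distance from `u` to `v`: the least weight of a walk (`⊤` if there is none). -/
noncomputable def wdist (adj : V → V → Prop) (w : V → V → ℕ) (u v : V) : ℕ∞ :=
  ⨅ (d : ℕ) (_ : WalkOfWeight adj w u v d), (d : ℕ∞)

/-- The eccentricity of `u`: the largest distance from `u` to a vertex. -/
noncomputable def weccent (adj : V → V → Prop) (w : V → V → ℕ) (u : V) : ℕ∞ :=
  ⨆ v, wdist adj w u v

theorem walkOfWeight_one_iff (G : SimpleGraph V) (u v : V) (d : ℕ) :
    WalkOfWeight G.Adj (fun _ _ => 1) u v d ↔ ∃ p : G.Walk u v, p.length = d := by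
  constructor
  · intro h
    induction h with
    | nil v => exact ⟨.nil, rfl⟩
    | cons h _ ih =>
      obtain ⟨p, rfl⟩ := ih
      exact ⟨.cons h p, by simp [add_comm]⟩
  · rintro ⟨p, rfl⟩
    induction p with
    | nil => exact .nil _
    | cons h p ih => simpa [add_comm] using WalkOfWeight.cons (w := fun _ _ => 1) h ih

/-- With all weights equal to `1` this is the usual eccentricity of an undirected graph. -/
theorem weccent_one_eq_eccent (G : SimpleGraph V) (u : V) :
    weccent G.Adj (fun _ _ => 1) u = G.eccent u := by
  have h : ∀ v, wdist G.Adj (fun _ _ => 1) u v = G.edist u v := by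
    intro v
    simp only [wdist, walkOfWeight_one_iff, SimpleGraph.edist]
    apply le_antisymm
    · exact le_iInf fun p => iInf₂_le p.length ⟨p, rfl⟩
    · refine le_iInf₂ fun d => ?_
      rintro ⟨p, rfl⟩
      exact iInf_le _ p
  simp only [weccent, h, SimpleGraph.eccent]

end Distance

/-! ### The inputs: connected simple graphs, given by the list of their edges -/

/-- A connected simple undirected graph on the vertices `0, …, n - 1`, with a list of its edges: every
edge occurs in the list exactly once, in one of its two orientations. A single vertex, which has no
edges, is excluded. -/
structure UndirectedGraph where
  n : ℕ
  two_le : 2 ≤ n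
  graph : SimpleGraph (Fin n)
  connected : graph.Connected
  edges : List (Fin n × Fin n)
  nodup : (edges.map fun e => s(e.1, e.2)).Nodup
  mem_edges : ∀ e, e ∈ edges.map (fun e => s(e.1, e.2)) ↔ e ∈ graph.edgeSet

/-- A strongly connected simple directed graph on the vertices `0, …, n - 1` (no loops, no parallel
edges; a pair of opposite edges is allowed), with a list of its edges. -/
structure DirectedGraph where
  n : ℕ
  two_le : 2 ≤ n
  graph : Digraph (Fin n)
  loopless : ∀ v, ¬ graph.Adj v v
  connected : ∀ u v, Relation.ReflTransGen graph.Adj u v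
  edges : List (Fin n × Fin n)
  nodup : edges.Nodup
  mem_edges : ∀ e, e ∈ edges ↔ graph.Adj e.1 e.2

/-- An undirected graph whose edge weights are positive integers of size at most `n ^ a`. -/
structure WeightedUndirectedGraph (a : ℕ) extends UndirectedGraph where
  weight : Sym2 (Fin n) → ℕ
  weight_pos : ∀ e ∈ graph.edgeSet, 0 < weight e
  weight_le : ∀ e ∈ graph.edgeSet, weight e ≤ n ^ a

/-- A directed graph whose edge weights are positive integers of size at most `n ^ a`. -/
structure WeightedDirectedGraph (a : ℕ) extends DirectedGraph where
  weight : Fin n → Fin n → ℕ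
  weight_pos : ∀ u v, graph.Adj u v → 0 < weight u v
  weight_le : ∀ u v, graph.Adj u v → weight u v ≤ n ^ a

/-! ### Graph problems and sub-`mn` algorithms -/

/-- A computational problem on graphs: the inputs, their numbers of vertices and edges, the way in
which they are written into the memory, and the memory contents that are correct answers. -/
structure GraphProblem where
  Input : Type
  numVertices : Input → ℕ
  numEdges : Input → ℕ
  encode : Input → List ℕ
  Correct : Input → (ℕ → ℕ) → Prop

/-- `g(m, n)` is sub-`mn`: `g(m, n) = O(m ^ α n ^ β)` for constants with `α + β < 2`. Here
`n ≥ 2` and `m ≥ n - 1`, as for connected graphs with at least one edge. -/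
def IsSubMN (g : ℕ → ℕ → ℝ) : Prop :=
  ∃ α β C : ℝ, α + β < 2 ∧
    ∀ m n : ℕ, 2 ≤ n → n ≤ m + 1 → g m n ≤ C * ((m : ℝ) ^ α * (n : ℝ) ^ β)

/-- The problem has an algorithm whose running time on graphs with `n` vertices and `m` edges is
bounded by a sub-`mn` function `g(m, n)`. -/
def HasSubMNAlgorithm (P : GraphProblem) : Prop :=
  ∃ (p : RAM.Cmd) (g : ℕ → ℕ → ℝ), IsSubMN g ∧
    RAM.SolvesWithin p P.encode P.Correct fun x => g (P.numEdges x) (P.numVertices x)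

/-! ### The four versions of Eccentricities

The input is `n`, `m`, and then for each edge its two end points and, in the weighted versions, its
weight. The output is the eccentricity of every vertex `v`, in memory cell `v`. -/

noncomputable def eccUndirected : GraphProblem where
  Input := UndirectedGraph
  numVertices G := G.n
  numEdges G := G.edges.length
  encode G := G.n :: G.edges.length :: G.edges.flatMap fun e => [(e.1 : ℕ), (e.2 : ℕ)]
  Correct G mem := ∀ v : Fin G.n, (mem v : ℕ∞) = G.graph.eccent v

noncomputable def eccDirected : GraphProblem where
  Input := DirectedGraph
  numVertices G := G.n
  numEdges G := G.edges.length
  encode G := G.n :: G.edges.length :: G.edges.flatMap fun e => [(e.1 : ℕ), (e.2 : ℕ)]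
  Correct G mem := ∀ v : Fin G.n, (mem v : ℕ∞) = weccent G.graph.Adj (fun _ _ => 1) v

noncomputable def eccWeightedUndirected (a : ℕ) : GraphProblem where
  Input := WeightedUndirectedGraph a
  numVertices G := G.n
  numEdges G := G.edges.length
  encode G := G.n :: G.edges.length ::
    G.edges.flatMap fun e => [(e.1 : ℕ), (e.2 : ℕ), G.weight s(e.1, e.2)]
  Correct G mem :=
    ∀ v : Fin G.n, (mem v : ℕ∞) = weccent G.graph.Adj (fun x y => G.weight s(x, y)) v

noncomputable def eccWeightedDirected (a : ℕ) : GraphProblem where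
  Input := WeightedDirectedGraph a
  numVertices G := G.n
  numEdges G := G.edges.length
  encode G := G.n :: G.edges.length ::
    G.edges.flatMap fun e => [(e.1 : ℕ), (e.2 : ℕ), G.weight e.1 e.2]
  Correct G mem := ∀ v : Fin G.n, (mem v : ℕ∞) = weccent G.graph.Adj G.weight v

/-! The reduction is "split and list". Let `h = ⌈n/2⌉`, split the variables of a `k`-CNF formula
into two halves of size `h` (with one dummy variable if `n` is odd), and take all `N = 2^h`
assignments of each half as vertices. With `M` clauses, every clause contributes three vertices: a
shared one, a left one and a right one. A half assignment that does not satisfy the clause is joined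
to the shared vertex, any other to the clause vertex of its own side. A left hub is joined to all
left assignments; a right hub is joined to all right assignments, all clause vertices and the left
hub.

From a right assignment `y`, everything except the left assignments is within distance 2. A left
assignment `x` is at distance 2 if some clause is satisfied by neither `x` nor `y`, since then the
shared vertex of that clause is a common neighbour, and otherwise at distance 3 via the two hubs. So
the eccentricity of `y` is 3 if `y` extends to a satisfying assignment and 2 if not
(`eccent_reductionGraph`, `satisfiable_iff`). Replacing edges by pairs of opposite arcs, or giving
them weight 1, does not change distances, so one graph serves all four versions.

Clauses are distinct, so `M ≤ (2n+1)^k` (`length_clauses_le`) and no sparsification is needed: the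
numbers of vertices and edges lie between `N` and `N · poly(n)`. A sub-`mn` algorithm therefore
takes time `N^γ · poly(n)` for some `γ < 2`, which is `O(2^(δ n))` with a `δ < 1` that does not
depend on `k` (`kSatInTime_of_computesEcc`). This contradicts SETH.

The remaining work is to implement the reduction in time `N · poly(n)` under logarithmic cost. The
subroutine expects zero registers and a memory with nothing but its input. Hence the formula is
packed into one number kept in a register while its cells are erased, and the registers of the
subroutine are renamed (`Exec.shift`). All variables stay below a bound `V` whose logarithm is
polynomial in `n`, so it suffices to count basic steps, each of which costs at most one `tick`
(`Runs`, `reduction_exec`, `overhead_le`). -/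

namespace RAM

/-! ### Renaming the registers of a program -/

/-- The program `p` with every register `i` renamed to `i + k`. -/
def Cmd.shift (k : ℕ) : Cmd → Cmd
  | .skip => .skip
  | .const d v => .const (d + k) v
  | .bin op d a b => .bin op (d + k) (a + k) (b + k)
  | .load d a => .load (d + k) (a + k)
  | .store a b => .store (a + k) (b + k)
  | .seq p q => .seq (p.shift k) (q.shift k)
  | .ite a p q => .ite (a + k) (p.shift k) (q.shift k)
  | .loop a p => .loop (a + k) (p.shift k)

/-- `S` simulates `s` with registers moved up by `k`; the first `k` registers of `S` are those
of `S₀`. -/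
structure ShiftSim (k : ℕ) (S₀ s S : State) : Prop where
  reg : ∀ i, S.reg (i + k) = s.reg i
  mem : S.mem = s.mem
  low : ∀ i < k, S.reg i = S₀.reg i

theorem ShiftSim.setReg {k : ℕ} {S₀ s S : State} (h : ShiftSim k S₀ s S) (d v : ℕ) :
    ShiftSim k S₀ (s.setReg d v) (S.setReg (d + k) v) where
  reg i := by
    by_cases hi : i = d
    · subst hi; simp [State.setReg]
    · simp [State.setReg, Function.update_of_ne, hi, h.reg]
  mem := h.mem
  low i hi := by
    have : i ≠ d + k := by omega
    simp [State.setReg, Function.update_of_ne, this, h.low i hi]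

theorem ShiftSim.setMem {k : ℕ} {S₀ s S : State} (h : ShiftSim k S₀ s S) (a v : ℕ) :
    ShiftSim k S₀ (s.setMem a v) (S.setMem a v) where
  reg := h.reg
  mem := by simp [State.setMem, h.mem]
  low := h.low

/-- Costs are charged on the contents of registers, never on their names, so renaming preserves the
running time exactly. -/
theorem Exec.shift {k : ℕ} {p : Cmd} {s s' : State} {t : ℕ} (h : Exec p s t s') :
    ∀ {S₀ S : State}, ShiftSim k S₀ s S →
      ∃ S', Exec (p.shift k) S t S' ∧ ShiftSim k S₀ s' S' := by
  induction h with
  | skip s => intro S₀ S h; exact ⟨S, .skip S, h⟩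
  | const s d v => intro S₀ S h; exact ⟨_, .const S _ v, h.setReg d v⟩
  | bin s op d a b =>
    intro S₀ S h
    have := Exec.bin S op (d + k) (a + k) (b + k)
    simp only [h.reg] at this
    exact ⟨_, this, h.setReg d _⟩
  | load s d a =>
    intro S₀ S h
    have := Exec.load S (d + k) (a + k)
    simp only [h.reg, h.mem] at this
    exact ⟨_, this, h.setReg d _⟩
  | store s a b =>
    intro S₀ S h
    have := Exec.store S (a + k) (b + k)
    simp only [h.reg] at this
    exact ⟨_, this, h.setMem _ _⟩
  | seq _ _ ih ih' =>
    intro S₀ S h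
    obtain ⟨S₁, e₁, h₁⟩ := ih h
    obtain ⟨S₂, e₂, h₂⟩ := ih' h₁
    exact ⟨S₂, .seq e₁ e₂, h₂⟩
  | @ite_true a p q s t s' hz _ ih =>
    intro S₀ S h
    obtain ⟨S₁, e₁, h₁⟩ := ih h
    have := Exec.ite_true (a := a + k) (q := q.shift k) (by rwa [h.reg]) e₁
    rw [h.reg] at this
    exact ⟨S₁, this, h₁⟩
  | @ite_false a p q s t s' hz _ ih =>
    intro S₀ S h
    obtain ⟨S₁, e₁, h₁⟩ := ih h
    have := Exec.ite_false (a := a + k) (p := p.shift k) (by rwa [h.reg]) e₁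
    rw [h.reg] at this
    exact ⟨S₁, this, h₁⟩
  | @loop_exit a p s hz =>
    intro S₀ S h
    have := Exec.loop_exit (a := a + k) (p := p.shift k) (s := S) (by rwa [h.reg])
    rw [h.reg] at this
    exact ⟨S, this, h⟩
  | @loop_step a p s t s' t' s'' hz _ _ ih ih' =>
    intro S₀ S h
    obtain ⟨S₁, e₁, h₁⟩ := ih h
    obtain ⟨S₂, e₂, h₂⟩ := ih' h₁
    have := Exec.loop_step (a := a + k) (by rwa [h.reg]) e₁ e₂
    rw [h.reg] at this
    exact ⟨S₂, this, h₂⟩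

/-! ### Arithmetic expressions -/

/-- Arithmetic expressions over numbered variables. -/
inductive Ex
  | var (i : ℕ)
  | lit (v : ℕ)
  | op (o : BinOp) (e f : Ex)

namespace Ex

instance : Add Ex := ⟨.op .add⟩
instance : Sub Ex := ⟨.op .sub⟩
instance : Mul Ex := ⟨.op .mul⟩
instance : Div Ex := ⟨.op .div⟩
instance (v : ℕ) : OfNat Ex v := ⟨.lit v⟩

/-- The value of an expression; `L` lists the values of the variables. -/
def val (L : List ℕ) : Ex → ℕ
  | var i => L.getD i 0
  | lit v => v
  | op o e f => o.eval (e.val L) (f.val L)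

def size : Ex → ℕ
  | var _ => 1
  | lit _ => 1
  | op _ e f => e.size + f.size + 1

/-- All variables are below `20` and all literals are at most `2`. -/
def Ok : Ex → Prop
  | var i => i < 20
  | lit v => v ≤ 2
  | op _ e f => e.Ok ∧ f.Ok

instance decidableOk : (e : Ex) → Decidable e.Ok
  | var i => inferInstanceAs (Decidable (i < 20))
  | lit v => inferInstanceAs (Decidable (v ≤ 2))
  | op _ e f => @instDecidableAnd _ _ (decidableOk e) (decidableOk f)

/-- A program that evaluates the expression into register `d`, using the registers from `d` on. -/
def code : Ex → ℕ → Cmd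
  | var i, d => .seq (.const d 0) (.bin .add d d i)
  | lit v, d => .const d v
  | op o e f, d => .seq (e.code d) (.seq (f.code (d + 1)) (.bin o d d (d + 1)))

/-- A product adds the exponents; for a sum, the operation node itself contributes a factor `V ≥ 2`,
which absorbs the doubling. -/
theorem val_le {V : ℕ} (hV : 2 ≤ V) {L : List ℕ} (hL : ∀ i, L.getD i 0 ≤ V) :
    ∀ e : Ex, e.Ok → e.val L ≤ V ^ e.size
  | var i, _ => by simpa [val, size] using hL i
  | lit v, h => by
    have : v ≤ 2 := h
    simp only [val, size, pow_one]; omega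
  | op o e f, h => by
    have he := val_le hV hL e h.1
    have hf := val_le hV hL f h.2
    have h1 : V ^ e.size ≤ V ^ (e.size + f.size) := Nat.pow_le_pow_right (by omega) (by omega)
    have h2 : V ^ f.size ≤ V ^ (e.size + f.size) := Nat.pow_le_pow_right (by omega) (by omega)
    have h3 : 2 * V ^ (e.size + f.size) ≤ V ^ (e.size + f.size + 1) := by
      rw [pow_succ, mul_comm]; exact Nat.mul_le_mul_left _ hV
    simp only [val, size]
    cases o with
    | add => simp only [BinOp.eval]; omega
    | sub => simp only [BinOp.eval]; omega
    | mul =>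
      simp only [BinOp.eval]
      have := Nat.mul_le_mul he hf
      rw [← pow_add] at this
      omega
    | div =>
      simp only [BinOp.eval]
      have := Nat.div_le_self (e.val L) (f.val L)
      omega

end Ex

theorem cost_mono {x y : ℕ} (h : x ≤ y) : cost x ≤ cost y :=
  Nat.succ_le_succ (Nat.size_le_size h)

/-- The code works as a stack machine: the second operand uses only registers from `d + 1` on, so
the first operand survives in `d`. Each node handles at most four numbers, all bounded by `V ^ z`.
-/
theorem Ex.code_exec {V : ℕ} (hV : 2 ≤ V) {L : List ℕ} (hL : ∀ i, L.getD i 0 ≤ V) {z : ℕ} :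
    ∀ (e : Ex) (d : ℕ) (S : State), e.Ok → e.size ≤ z → 20 ≤ d →
      (∀ i < 20, S.reg i = L.getD i 0) →
      ∃ t S', Exec (e.code d) S t S' ∧ t ≤ 4 * e.size * cost (V ^ z) ∧ S'.reg d = e.val L ∧
        S'.mem = S.mem ∧ ∀ r, r < d ∨ d + e.size ≤ r → S'.reg r = S.reg r
  | .var i, d, S, ok, hz, hd, hS => by
    have hi : i < 20 := ok
    simp only [size] at hz
    have hVz : V ≤ V ^ z := Nat.le_self_pow (by omega) V
    refine ⟨_, _, .seq (.const S d 0) (.bin _ .add d d i), ?_, ?_, rfl, ?_⟩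
    · have h1 : (S.setReg d 0).reg d = 0 := by simp [State.setReg]
      have h2 : (S.setReg d 0).reg i = L.getD i 0 := by
        rw [← hS i hi]; simp [State.setReg, Function.update_of_ne (show i ≠ d by omega)]
      rw [h1, h2]
      have := cost_mono (Nat.zero_le (V ^ z))
      have := cost_mono ((hL i).trans hVz)
      simp only [size]; omega
    · simp [State.setReg, BinOp.eval, val, Function.update_of_ne (show i ≠ d by omega), hS i hi]
    · intro r hr
      simp only [size] at hr
      simp [State.setReg, Function.update_of_ne (show r ≠ d by omega)]
  | .lit v, d, S, ok, hz, hd, hS => by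
    have hv : v ≤ 2 := ok
    simp only [size] at hz
    have hVz : V ≤ V ^ z := Nat.le_self_pow (by omega) V
    refine ⟨_, _, .const S d v, ?_, by simp [State.setReg, val], rfl, ?_⟩
    · have := cost_mono ((hv.trans hV).trans hVz)
      simp only [size]; omega
    · intro r hr
      simp only [size] at hr
      simp [State.setReg, Function.update_of_ne (show r ≠ d by omega)]
  | .op o e f, d, S, ok, hz, hd, hS => by
    simp only [size] at hz
    obtain ⟨t₁, S₁, x₁, ht₁, v₁, m₁, r₁⟩ := code_exec hV hL (z := z) e d S ok.1 (by omega) hd hS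
    have hS₁ : ∀ i < 20, S₁.reg i = L.getD i 0 := fun i hi => by
      rw [r₁ i (by omega), hS i hi]
    obtain ⟨t₂, S₂, x₂, ht₂, v₂, m₂, r₂⟩ :=
      code_exec hV hL (z := z) f (d + 1) S₁ ok.2 (by omega) (by omega) hS₁
    have v₁' : S₂.reg d = e.val L := by rw [r₂ d (by omega), v₁]
    have hpow : ∀ {x}, x ≤ z → V ^ x ≤ V ^ z := fun h => Nat.pow_le_pow_right (by omega) h
    refine ⟨_, _, .seq x₁ (.seq x₂ (.bin S₂ o d d (d + 1))), ?_, ?_, ?_, ?_⟩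
    · rw [v₁', v₂]
      have := cost_mono ((val_le hV hL e ok.1).trans (hpow (by omega)))
      have := cost_mono ((val_le hV hL f ok.2).trans (hpow (by omega)))
      have : 4 * (e.size + f.size + 1) * cost (V ^ z) =
        4 * e.size * cost (V ^ z) + 4 * f.size * cost (V ^ z) + 4 * cost (V ^ z) := by ring
      simp only [size]; omega
    · simp [State.setReg, val, v₁', v₂]
    · simp [State.setReg, m₁, m₂]
    · intro r hr
      simp only [size] at hr
      simp only [State.setReg]
      rw [Function.update_of_ne (show r ≠ d by omega), r₂ r (by omega), r₁ r (by omega)]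

/-! ### Assignments, memory access, and a logic of bounded runs -/

def asg (x : ℕ) (e : Ex) : Cmd := .seq (e.code 20) (.seq (.const x 0) (.bin .add x x 20))

def ld (x : ℕ) (e : Ex) : Cmd := .seq (e.code 20) (.load x 20)

/-- Expressions will have size at most `24`, so the address uses registers `20` to `43` and the
value `44` to `67`. Everything from `70` on is left to the subroutine. -/
def st (e f : Ex) : Cmd := .seq (e.code 20) (.seq (f.code 44) (.store 20 44))

/-- The unit of time: an upper bound for the time of a basic step when all variables are at most
`V`. -/
def tick (V : ℕ) : ℕ := 200 * cost (V ^ 24)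

/-- The registers `0, …, 13` contain the list `L` of numbers of size at most `V`, and the memory
is `m`. -/
structure Matches (V : ℕ) (L : List ℕ) (m : ℕ → ℕ) (S : State) : Prop where
  length : L.length = 14
  le : ∀ x ∈ L, x ≤ V
  reg : ∀ i < 20, S.reg i = L.getD i 0
  mem : S.mem = m

theorem Matches.getD_le {V : ℕ} {L : List ℕ} {m : ℕ → ℕ} {S : State} (h : Matches V L m S)
    (i : ℕ) : L.getD i 0 ≤ V := by
  by_cases hi : i < L.length
  · rw [List.getD_eq_getElem _ _ hi]; exact h.le _ (List.getElem_mem hi)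
  · rw [List.getD_eq_default _ _ (by omega)]; omega

/-- Started with variables `L` and memory `m`, the program `c` halts within `T` ticks with variables
and memory satisfying `Q`, and leaves the registers from `70` on unchanged. -/
def Runs (V : ℕ) (c : Cmd) (T : ℕ) (L : List ℕ) (m : ℕ → ℕ)
    (Q : List ℕ → (ℕ → ℕ) → Prop) : Prop :=
  ∀ S, Matches V L m S → ∃ t S' L' m', Exec c S t S' ∧ t ≤ T * tick V ∧ Matches V L' m' S' ∧
    Q L' m' ∧ ∀ i, 70 ≤ i → S'.reg i = S.reg i

namespace Runs

variable {V : ℕ} {c p q : Cmd} {T T₁ T₂ : ℕ} {L : List ℕ} {m : ℕ → ℕ}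
  {Q R : List ℕ → (ℕ → ℕ) → Prop}

theorem mono (h : Runs V c T₁ L m Q) (hT : T₁ ≤ T₂) : Runs V c T₂ L m Q := fun S hS => by
  obtain ⟨t, S', L', m', h1, h2, h3⟩ := h S hS
  exact ⟨t, S', L', m', h1, h2.trans (Nat.mul_le_mul_right _ hT), h3⟩

/-- The bounds on the variables are part of `Matches`, so they can be recalled at any point instead
of being carried as hypotheses. -/
theorem of_le (h : (∀ x ∈ L, x ≤ V) → Runs V c T L m Q) : Runs V c T L m Q :=
  fun S hS => h hS.le S hS

/-- Weakest-precondition form: the postcondition of `p` says that `q` runs. Programs can thus be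
verified by symbolic execution from the front, one refinement per instruction. -/
theorem seq (h : Runs V p T₁ L m fun L' m' => Runs V q T₂ L' m' Q) :
    Runs V (.seq p q) (T₂ + T₁) L m Q := fun S hS => by
  obtain ⟨t, S', L', m', h1, h2, h3, h4, h5⟩ := h S hS
  obtain ⟨t', S'', L'', m'', h1', h2', h3', h4', h5'⟩ := h4 S' h3
  refine ⟨_, S'', L'', m'', .seq h1 h1', ?_, h3', h4', fun i hi => by rw [h5' i hi, h5 i hi]⟩
  rw [add_mul]; omega

theorem step (h : Runs V p 1 L m fun L' m' => Runs V q T L' m' Q) :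
    Runs V (.seq p q) (T + 1) L m Q := seq h

theorem one_le_tick (V : ℕ) : 1 ≤ tick V := by
  unfold tick cost; omega

theorem skip (h : Q L m) : Runs V .skip 1 L m Q := fun S hS =>
  ⟨1, S, L, m, .skip S, by have := one_le_tick V; omega, hS, h, fun _ _ => rfl⟩

theorem cost_le_tick (_hV : 2 ≤ V) {x : ℕ} (h : x ≤ V) : 50 * cost x ≤ tick V := by
  have : cost x ≤ cost (V ^ 24) := cost_mono (h.trans (Nat.le_self_pow (by omega) V))
  unfold tick; omega

theorem matches_set {S S' : State} (hS : Matches V L m S) {x v : ℕ} (hx : x < 14) (hv : v ≤ V)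
    (hr : ∀ i < 20, S'.reg i = Function.update S.reg x v i) (hm : S'.mem = m) :
    Matches V (L.set x v) m S' where
  length := by rw [List.length_set, hS.length]
  le y hy := by
    rcases List.mem_or_eq_of_mem_set hy with h | h
    · exact hS.le y h
    · exact h ▸ hv
  reg i hi := by
    rw [hr i hi]
    have hl := hS.length
    by_cases h : i = x
    · subst h; simp [List.getD_eq_getElem?_getD, hl, hx]
    · rw [Function.update_of_ne h, hS.reg i hi]
      simp [List.getD_eq_getElem?_getD, Ne.symm h]
  mem := hm

theorem asg (hV : 2 ≤ V) {x : ℕ} {e : Ex} (v : ℕ)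
    (hv : e.val L = v) (hle : v ≤ V) (h : Q (L.set x v) m)
    (hx : x < 14 := by decide) (ok : e.Ok ∧ e.size ≤ 24 := by decide) :
    Runs V (RAM.asg x e) 1 L m Q := by
  intro S hS
  obtain ⟨t, S₁, h₁, ht, hr, hm, hf⟩ :=
    Ex.code_exec hV hS.getD_le (z := 24) e 20 S ok.1 ok.2 le_rfl hS.reg
  have hes := ok.2
  have e2 : (S₁.setReg x 0).reg 20 = v := by
    simp only [State.setReg]; rw [Function.update_of_ne (by omega), hr, hv]
  have e1 : (S₁.setReg x 0).reg x = 0 := by simp [State.setReg]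
  refine ⟨_, _, L.set x v, m, .seq h₁ (.seq (.const S₁ x 0) (.bin _ .add x x 20)), ?_, ?_, h, ?_⟩
  · rw [e1, e2]
    have h1 := cost_mono (Nat.zero_le (V ^ 24))
    have h2 := cost_mono (hle.trans (Nat.le_self_pow (n := 24) (by omega) V))
    have h3 : 4 * e.size * cost (V ^ 24) ≤ 96 * cost (V ^ 24) := Nat.mul_le_mul_right _ (by omega)
    unfold tick; omega
  · refine matches_set hS hx hle (fun i hi => ?_) (by simp [State.setReg, hm, hS.mem])
    rw [e1, e2]
    by_cases h : i = x
    · subst h; simp [State.setReg, BinOp.eval]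
    · simp [State.setReg, Function.update_of_ne h, hf i (by omega)]
  · intro i hi
    simp only [State.setReg]
    rw [Function.update_of_ne (by omega), Function.update_of_ne (by omega), hf i (by omega)]

theorem ld (hV : 2 ≤ V) {x : ℕ} {e : Ex} (a v : ℕ)
    (ha : e.val L = a) (hv : m a = v) (hle : v ≤ V) (h : Q (L.set x v) m)
    (hx : x < 14 := by decide) (ok : e.Ok ∧ e.size ≤ 24 := by decide) :
    Runs V (RAM.ld x e) 1 L m Q := by
  intro S hS
  obtain ⟨t, S₁, h₁, ht, hr, hm, hf⟩ :=
    Ex.code_exec hV hS.getD_le (z := 24) e 20 S ok.1 ok.2 le_rfl hS.reg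
  have hes := ok.2
  have hmem : S₁.mem (S₁.reg 20) = v := by rw [hm, hS.mem, hr, ha, hv]
  refine ⟨_, _, L.set x v, m, .seq h₁ (.load S₁ x 20), ?_, ?_, h, ?_⟩
  · rw [hmem, hr]
    have h1 := cost_mono ((Ex.val_le hV hS.getD_le e ok.1).trans
      (Nat.pow_le_pow_right (by omega) ok.2))
    have h2 := cost_mono (hle.trans (Nat.le_self_pow (n := 24) (by omega) V))
    have h3 : 4 * e.size * cost (V ^ 24) ≤ 96 * cost (V ^ 24) := Nat.mul_le_mul_right _ (by omega)
    unfold tick; omega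
  · refine matches_set hS hx hle (fun i hi => ?_) (by simp [State.setReg, hm, hS.mem])
    rw [hmem]
    by_cases h : i = x
    · subst h; simp [State.setReg]
    · simp [State.setReg, Function.update_of_ne h, hf i (by omega)]
  · intro i hi
    simp only [State.setReg]
    rw [Function.update_of_ne (by omega), hf i (by omega)]

theorem st (hV : 2 ≤ V) {e f : Ex} (a v : ℕ) (ha : e.val L = a) (hv : f.val L = v)
    (h : Q L (Function.update m a v))
    (ok : (e.Ok ∧ e.size ≤ 24) ∧ f.Ok ∧ f.size ≤ 24 := by decide) :
    Runs V (RAM.st e f) 1 L m Q := by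
  intro S hS
  obtain ⟨⟨ok1, hes⟩, ok2, hfs⟩ := ok
  obtain ⟨t, S₁, h₁, ht, hr, hm, hf⟩ :=
    Ex.code_exec hV hS.getD_le (z := 24) e 20 S ok1 hes le_rfl hS.reg
  have hS₁ : ∀ i < 20, S₁.reg i = L.getD i 0 := fun i hi => by rw [hf i (by omega), hS.reg i hi]
  obtain ⟨t', S₂, h₂, ht', hr', hm', hf'⟩ :=
    Ex.code_exec hV hS.getD_le (z := 24) f 44 S₁ ok2 hfs (by omega) hS₁
  have hr2 : S₂.reg 20 = a := by rw [hf' 20 (by omega), hr, ha]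
  refine ⟨_, _, L, _, .seq h₁ (.seq h₂ (.store S₂ 20 44)), ?_, ⟨hS.length, hS.le, ?_, ?_⟩, h, ?_⟩
  · rw [hr2, hr', ← ha]
    have h1 := cost_mono ((Ex.val_le hV hS.getD_le e ok1).trans
      (Nat.pow_le_pow_right (by omega) hes))
    have h2 := cost_mono ((Ex.val_le hV hS.getD_le f ok2).trans
      (Nat.pow_le_pow_right (by omega) hfs))
    have h3 : 4 * e.size * cost (V ^ 24) ≤ 96 * cost (V ^ 24) := Nat.mul_le_mul_right _ (by omega)
    have h4 : 4 * f.size * cost (V ^ 24) ≤ 96 * cost (V ^ 24) := Nat.mul_le_mul_right _ (by omega)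
    unfold tick; omega
  · intro i hi
    simp only [State.setMem]
    rw [hf' i (by omega), hS₁ i hi]
  · simp only [State.setMem, hr2, hr', hv, hm', hm, hS.mem]
  · intro i hi
    simp only [State.setMem]
    rw [hf' i (by omega), hf i (by omega)]

theorem ite_true {x : ℕ} (hV : 2 ≤ V) (h0 : L.getD x 0 ≠ 0) (h : Runs V p T L m Q)
    (hx : x < 20 := by decide) :
    Runs V (.ite x p q) (T + 1) L m Q := fun S hS => by
  obtain ⟨t, S', L', m', h1, h2, h3⟩ := h S hS
  refine ⟨_, S', L', m', .ite_true (by rwa [hS.reg x hx]) h1, ?_, h3⟩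
  have := cost_le_tick hV (hS.getD_le x)
  rw [hS.reg x hx, add_mul]; omega

theorem ite_false {x : ℕ} (hV : 2 ≤ V) (h0 : L.getD x 0 = 0) (h : Runs V q T L m Q)
    (hx : x < 20 := by decide) : Runs V (.ite x p q) (T + 1) L m Q := fun S hS => by
  obtain ⟨t, S', L', m', h1, h2, h3⟩ := h S hS
  refine ⟨_, S', L', m', .ite_false (by rwa [hS.reg x hx]) h1, ?_, h3⟩
  have := cost_le_tick hV (hS.getD_le x)
  rw [hS.reg x hx, add_mul]; omega

theorem ite {x : ℕ} (hV : 2 ≤ V) (h₁ : L.getD x 0 ≠ 0 → Runs V p T L m Q)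
    (h₂ : L.getD x 0 = 0 → Runs V q T L m Q) (hx : x < 20 := by decide) :
    Runs V (.ite x p q) (T + 1) L m Q :=
  if h : L.getD x 0 = 0 then ite_false hV h (h₂ h) hx else ite_true hV h (h₁ h) hx

theorem loop_exit {x : ℕ} (hV : 2 ≤ V) (h0 : L.getD x 0 = 0) (h : Q L m)
    (hx : x < 20 := by decide) :
    Runs V (.loop x p) 1 L m Q := fun S hS => by
  refine ⟨_, S, L, m, .loop_exit (by rwa [hS.reg x hx]), ?_, hS, h, fun _ _ => rfl⟩
  have := cost_le_tick hV (hS.getD_le x)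
  rw [hS.reg x hx]; omega

theorem loop_step {x : ℕ} (hV : 2 ≤ V) (h0 : L.getD x 0 ≠ 0)
    (h : Runs V p T₁ L m fun L' m' => Runs V (.loop x p) T₂ L' m' Q)
    (hx : x < 20 := by decide) :
    Runs V (.loop x p) (T₂ + (T₁ + 1)) L m Q := fun S hS => by
  obtain ⟨t, S', L', m', h1, h2, h3, h4, h5⟩ := h S hS
  obtain ⟨t', S'', L'', m'', h1', h2', h3', h4', h5'⟩ := h4 S' h3
  refine ⟨_, S'', L'', m'', .loop_step (by rwa [hS.reg x hx]) h1 h1', ?_, h3', h4',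
    fun i hi => by rw [h5' i hi, h5 i hi]⟩
  have := cost_le_tick hV (hS.getD_le x)
  rw [hS.reg x hx, add_mul, add_mul]; omega

end Runs

open Ex

infixr:60 " ;; " => Cmd.seq

variable {V : ℕ}

/-! ### Powers of two -/

/-- Multiply register `8` by two to the power of register `9`. -/
def powLoop : Cmd := .loop 9 (asg 8 (2 * var 8) ;; asg 9 (var 9 - 1))

theorem powLoop_runs (hV : 2 ≤ V) {a₀ a₁ a₂ a₃ a₄ a₅ a₆ a₇ b₀ b₁ b₂ b₃ : ℕ} {m : ℕ → ℕ}
    {Q : List ℕ → (ℕ → ℕ) → Prop} :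
    ∀ (i P : ℕ), P * 2 ^ i ≤ V →
      Q [a₀, a₁, a₂, a₃, a₄, a₅, a₆, a₇, P * 2 ^ i, 0, b₀, b₁, b₂, b₃] m →
      Runs V powLoop (3 * i + 1) [a₀, a₁, a₂, a₃, a₄, a₅, a₆, a₇, P, i, b₀, b₁, b₂, b₃] m Q
  | 0, P, _, h => .loop_exit hV rfl (by simpa using h)
  | i + 1, P, hP, h => Runs.of_le fun hL => by
    have hi : i + 1 ≤ V := hL _ (by simp)
    have e : 2 * P * 2 ^ i = P * 2 ^ (i + 1) := by ring
    have : 2 * P * 1 ≤ 2 * P * 2 ^ i := Nat.mul_le_mul_left _ Nat.one_le_two_pow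
    refine .loop_step (T₁ := 2) hV (Nat.succ_ne_zero i) ?_
    refine .step (.asg hV (2 * P) rfl (by omega) ?_)
    refine .asg hV i rfl (by omega) ?_
    exact powLoop_runs hV i (2 * P) (by omega) (by rwa [e])

/-! ### Reading a formula into a single number -/

/-- The memory with `rest` from cell `p` on and zeros before. -/
def tailMem (p : ℕ) (rest : List ℕ) (i : ℕ) : ℕ := if i < p then 0 else rest.getD (i - p) 0

theorem tailMem_cons_self (p x : ℕ) (r : List ℕ) : tailMem p (x :: r) p = x := by
  simp [tailMem]

/-- Erasing each cell once it is read is what leaves the memory zero at the end, as required before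
the graph is written. -/
theorem update_tailMem (p x : ℕ) (r : List ℕ) :
    Function.update (tailMem p (x :: r)) p 0 = tailMem (p + 1) r := by
  funext i
  by_cases h : i = p
  · subst h; simp [tailMem]
  · rw [Function.update_of_ne h]
    unfold tailMem
    by_cases h1 : i < p
    · rw [if_pos h1, if_pos (by omega)]
    · rw [if_neg h1, if_neg (by omega), show i - p = i - (p + 1) + 1 by omega, List.getD_cons_succ]

theorem tailMem_nil (p : ℕ) : tailMem p [] = fun _ => 0 := by
  funext i; simp [tailMem]

/-- The base of the number system in which formulas are written, for `2 h` variables. -/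
def base (h : ℕ) : ℕ := 2 * 2 ^ h * 2 ^ h * 2 ^ h * 2 ^ h

/-- The bit that belongs to the literal with code `l`. -/
def litPos (h l : ℕ) : ℕ := l / 2 + (if l % 2 = 0 then h else 0) + (if l / 2 < h then 0 else h)

/-- The factor `2` keeps literal digits apart from the clause mark `1`; halving a digit recovers the
power of two. -/
def litDigit (h l : ℕ) : ℕ := 2 * 2 ^ litPos h l

/-- The digits of a list of clauses on top of the digits `D`: every clause is its literals in
reverse order, followed by the digit `1`. -/
def pushClauses (h : ℕ) : List (List ℕ) → List ℕ → List ℕ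
  | [], D => D
  | c :: cs, D => pushClauses h cs ((c.map (litDigit h)).reverse ++ 1 :: D)

theorem pushClauses_eq (h : ℕ) : ∀ (cs : List (List ℕ)) (D : List ℕ), pushClauses h cs D =
    (cs.reverse.flatMap fun c => (c.map (litDigit h)).reverse ++ [1]) ++ D
  | [], D => rfl
  | c :: cs, D => by
    rw [pushClauses, pushClauses_eq h cs]
    simp

theorem base_eq (h : ℕ) : base h = 2 ^ (4 * h + 1) := by
  unfold base; ring

theorem two_le_base (h : ℕ) : 2 ≤ base h := by
  rw [base_eq, pow_succ]
  have := Nat.one_le_two_pow (n := 4 * h)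
  omega

theorem litDigit_lt {h l : ℕ} (hl : l < 4 * h) : litDigit h l < base h := by
  rw [base_eq, litDigit, mul_comm, ← pow_succ]
  apply Nat.pow_lt_pow_right (by norm_num)
  unfold litPos
  split_ifs <;> omega

/-- Register `0` holds `2^h`, `2` the base, `3` the packed formula, `4` the input pointer, `6` the
number of literals left in the clause, `7` the literal, `10` the number `h`. Register `12` is
nonzero if the variable is in the first half, `11` is the sign; multiplying by register `0` moves
the bit up by `h`. -/
def readLiteral : Cmd :=
  ld 7 (var 4) ;; st (var 4) 0 ;; asg 4 (var 4 + 1) ;;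
  asg 9 (var 7 / 2) ;; asg 11 (var 7 - 2 * var 9) ;; asg 12 (var 10 - var 9) ;;
  .ite 12 (asg 8 2) (asg 8 (2 * var 0)) ;;
  .ite 11 .skip (asg 8 (var 8 * var 0)) ;;
  powLoop ;;
  asg 3 (var 3 * var 2 + var 8) ;; asg 6 (var 6 - 1)

def readLiterals : Cmd := .loop 6 readLiteral

/-- The mark `1` is pushed before the literals; since later digits are less significant, it is met
after them when the number is taken apart. -/
def readClause : Cmd :=
  asg 3 (var 3 * var 2 + 1) ;; ld 6 (var 4) ;; st (var 4) 0 ;; asg 4 (var 4 + 1) ;;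
  readLiterals ;; asg 5 (var 5 - 1)

def readClauses : Cmd := .loop 5 readClause

theorem ofDigits_le {b : ℕ} (hb : 2 ≤ b) {D : List ℕ} (hD : ∀ d ∈ D, d < b) {X : ℕ}
    (hX : D.length ≤ X) (h : b ^ X ≤ V) : Nat.ofDigits b D ≤ V :=
  ((Nat.ofDigits_lt_base_pow_length (by omega) hD).le.trans
    (Nat.pow_le_pow_right (by omega) hX)).trans h

theorem readLiteral_runs (hV : 2 ≤ V) {h M F p r q l : ℕ} {a b c d e f : ℕ} {rest : List ℕ}
    (hl : l < 4 * h) (hlV : l ≤ V) (hp : p + 1 ≤ V) (hB : base h ≤ V)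
    (hF : litDigit h l + base h * F ≤ V) {Q : List ℕ → (ℕ → ℕ) → Prop}
    (H : ∀ a b c d e, Q [2 ^ h, M, base h, litDigit h l + base h * F, p + 1, r, q, a, b, c, h, d,
      e, f] (tailMem (p + 1) rest)) :
    Runs V readLiteral (6 * h + 16) [2 ^ h, M, base h, F, p, r, q + 1, a, b, c, h, d, e, f]
      (tailMem p (l :: rest)) Q := Runs.of_le fun hL => by
  have hN : 2 ^ h ≤ V := hL _ (by simp)
  have hh : h ≤ V := hL _ (by simp)
  have hq : q + 1 ≤ V := hL _ (by simp)
  have hdig := (litDigit_lt hl).le.trans hB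
  have h2N : 2 * 2 ^ h ≤ V := by
    refine le_trans ?_ hB
    rw [base_eq, ← pow_succ']
    exact Nat.pow_le_pow_right (by norm_num) (by omega)
  have h2NN : 2 * 2 ^ h * 2 ^ h ≤ V := by
    refine le_trans ?_ hB
    rw [base_eq, ← pow_succ', ← pow_add]
    exact Nat.pow_le_pow_right (by norm_num) (by omega)
  have hmod : l % 2 < 2 := Nat.mod_lt _ (by norm_num)
  -- `P₁` accounts for the half in which the variable lies and `P₂` also for the sign; `powLoop`
  -- then supplies the last factor `2 ^ (l / 2)`.
  obtain ⟨P₁, hP₁⟩ : ∃ P, P = if l / 2 < h then 2 else 2 * 2 ^ h := ⟨_, rfl⟩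
  obtain ⟨P₂, hP₂⟩ : ∃ P, P = P₁ * if l % 2 = 0 then 2 ^ h else 1 := ⟨_, rfl⟩
  have key : P₂ * 2 ^ (l / 2) = litDigit h l := by
    unfold litDigit litPos
    rw [hP₂, hP₁]
    split_ifs <;> simp only [pow_add] <;> ring
  have hP₂V : P₂ ≤ V :=
    (Nat.le_mul_of_pos_right _ (Nat.pow_pos (by norm_num))).trans (key.le.trans hdig)
  have H₁ : Runs V (powLoop ;; asg 3 (var 3 * var 2 + var 8) ;; asg 6 (var 6 - 1))
      (2 + (3 * (l / 2) + 1)) [2 ^ h, M, base h, F, p + 1, r, q + 1, l, P₂, l / 2, h, l % 2,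
        h - l / 2, f] (tailMem (p + 1) rest) Q := by
    refine .seq (powLoop_runs hV _ _ (by omega) ?_)
    rw [key]
    refine .step (.asg hV (litDigit h l + base h * F) ?_ hF ?_)
    · exact (Nat.add_comm _ _).trans (congrArg _ (Nat.mul_comm _ _))
    exact .asg hV q rfl (by omega) (H _ _ _ _ _)
  have H₂ : Runs V (.ite 11 .skip (asg 8 (var 8 * var 0)) ;; powLoop ;;
      asg 3 (var 3 * var 2 + var 8) ;; asg 6 (var 6 - 1))
      (2 + (3 * (l / 2) + 1) + 2) [2 ^ h, M, base h, F, p + 1, r, q + 1, l, P₁, l / 2, h, l % 2,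
        h - l / 2, f] (tailMem (p + 1) rest) Q := by
    refine .seq (T₁ := 2) (.ite hV (fun hc => .skip ?_) fun hc => .asg hV P₂ ?_ hP₂V H₁)
    · have hc : l % 2 ≠ 0 := hc
      rw [if_neg hc, mul_one] at hP₂
      exact hP₂ ▸ H₁
    · have hc : l % 2 = 0 := hc
      rw [if_pos hc] at hP₂
      exact hP₂.symm
  refine .mono (T₁ := 2 + (3 * (l / 2) + 1) + 2 + 2 + 1 + 1 + 1 + 1 + 1 + 1) ?_ (by omega)
  unfold readLiteral
  refine .step (.ld hV p l rfl (tailMem_cons_self p l rest) hlV ?_)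
  refine .step (.st hV p 0 rfl rfl ?_)
  rw [update_tailMem]
  refine .step (.asg hV (p + 1) rfl hp ?_)
  refine .step (.asg hV (l / 2) rfl (by omega) ?_)
  refine .step (.asg hV (l % 2) (?_ : l - 2 * (l / 2) = l % 2) (by omega) ?_)
  · omega
  refine .step (.asg hV (h - l / 2) rfl (by omega) ?_)
  refine .seq (T₁ := 2) (.ite hV (fun hc => .asg hV P₁ ?_ ?_ H₂) fun hc => .asg hV P₁ ?_ ?_ H₂)
  · have hc : h - l / 2 ≠ 0 := hc
    exact (hP₁.trans (if_pos (by omega))).symm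
  · rw [hP₁]; split_ifs <;> omega
  · have hc : h - l / 2 = 0 := hc
    exact (hP₁.trans (if_neg (by omega))).symm
  · rw [hP₁]; split_ifs <;> omega

theorem readLiterals_runs (hV : 2 ≤ V) {h M r X : ℕ} (hB : base h ≤ V) (hX : base h ^ X ≤ V)
    {rest : List ℕ} {Q : List ℕ → (ℕ → ℕ) → Prop} :
    ∀ (ls D : List ℕ) (p a b c d e f : ℕ), (∀ l ∈ ls, l < 4 * h ∧ l ≤ V) → (∀ x ∈ D, x < base h) →
      p + ls.length ≤ V → ls.length + D.length ≤ X →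
      (∀ a b c d e, Q [2 ^ h, M, base h,
        Nat.ofDigits (base h) ((ls.map (litDigit h)).reverse ++ D), p + ls.length, r, 0, a, b, c,
        h, d, e, f] (tailMem (p + ls.length) rest)) →
      Runs V readLiterals (ls.length * (6 * h + 17) + 1)
        [2 ^ h, M, base h, Nat.ofDigits (base h) D, p, r, ls.length, a, b, c, h, d, e, f]
        (tailMem p (ls ++ rest)) Q := by
  intro ls
  induction ls with
  | nil =>
    intro D p a b c d e f _ _ _ _ H
    refine .mono (.loop_exit hV rfl ?_) (Nat.le_add_left _ _)
    simpa using H a b c d e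
  | cons l ls ih =>
    intro D p a b c d e f hls hD hp hlen H
    have hD' : ∀ x ∈ litDigit h l :: D, x < base h := by
      simpa using ⟨litDigit_lt (hls l (by simp)).1, hD⟩
    simp only [List.length_cons] at hp hlen H ⊢
    refine .mono (T₁ := ls.length * (6 * h + 17) + 1 + (6 * h + 16 + 1)) ?_ (by nlinarith)
    refine .loop_step hV (Nat.succ_ne_zero _) ?_
    refine readLiteral_runs hV (hls l (by simp)).1 (hls l (by simp)).2 (by omega) hB ?_ ?_
    · rw [← Nat.ofDigits_cons]
      exact ofDigits_le (two_le_base h) hD' (by simp only [List.length_cons]; omega) hX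
    intro a b c d e
    rw [← Nat.ofDigits_cons]
    refine ih _ (p + 1) a b c d e f
      (fun x hx => hls x (by simp [hx])) hD' (by omega) (by simp only [List.length_cons]; omega) ?_
    intro a b c d e
    have := H a b c d e
    rw [show p + 1 + ls.length = p + (ls.length + 1) by omega]
    simpa using this

/-- A list of clauses, every clause preceded by its length. -/
def clauseCells (cs : List (List ℕ)) : List ℕ := cs.flatMap fun c => c.length :: c

/-- `X` bounds the number of digits after all clauses are read, so every intermediate packed number
is at most `base h ^ X ≤ V`. -/
theorem readClauses_runs (hV : 2 ≤ V) {h M X k : ℕ} (hB : base h ≤ V) (hX : base h ^ X ≤ V)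
    {Q : List ℕ → (ℕ → ℕ) → Prop} :
    ∀ (cs : List (List ℕ)) (D : List ℕ) (p a b c d e f g : ℕ),
      (∀ c ∈ cs, c.length ≤ k ∧ ∀ l ∈ c, l < 4 * h ∧ l ≤ V) → (∀ x ∈ D, x < base h) →
      p + (clauseCells cs).length ≤ V → (clauseCells cs).length + D.length ≤ X →
      (∀ p a b c d e f g, Q [2 ^ h, M, base h, Nat.ofDigits (base h) (pushClauses h cs D), p, 0,
        a, b, c, d, h, e, f, g] fun _ => 0) →
      Runs V readClauses (cs.length * (k * (6 * h + 17) + 7) + 1)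
        [2 ^ h, M, base h, Nat.ofDigits (base h) D, p, cs.length, a, b, c, d, h, e, f, g]
        (tailMem p (clauseCells cs)) Q := by
  intro cs
  induction cs with
  | nil =>
    intro D p a b c d e f g _ _ _ _ H
    refine .mono (.loop_exit hV rfl ?_) (Nat.le_add_left _ _)
    rw [show clauseCells [] = [] from rfl, tailMem_nil]
    exact H p a b c d e f g
  | cons cl cs ih =>
    intro D p a b c d e f g hcs hD hp hlen H
    refine Runs.of_le fun hL => ?_
    have hcl := hcs cl (by simp)
    have hr : cs.length + 1 ≤ V := hL _ (by simp)
    have hD' : ∀ x ∈ 1 :: D, x < base h := by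
      have := two_le_base h
      simpa using ⟨by omega, hD⟩
    have hdig : ∀ x ∈ (cl.map (litDigit h)).reverse ++ 1 :: D, x < base h := by
      intro x hx
      rcases List.mem_append.1 hx with hx | hx
      · simp only [List.mem_reverse, List.mem_map] at hx
        obtain ⟨l, hl, rfl⟩ := hx
        exact litDigit_lt (hcl.2 l hl).1
      · exact hD' x hx
    have e : clauseCells (cl :: cs) = cl.length :: (cl ++ clauseCells cs) := by simp [clauseCells]
    have el : (clauseCells (cl :: cs)).length = cl.length + (clauseCells cs).length + 1 := by
      rw [e]; simp
    rw [el] at hp hlen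
    rw [e]
    simp only [List.length_cons]
    have hk : cl.length * (6 * h + 17) ≤ k * (6 * h + 17) := Nat.mul_le_mul_right _ hcl.1
    refine .mono (T₁ := cs.length * (k * (6 * h + 17) + 7) + 1 +
      (1 + (cl.length * (6 * h + 17) + 1) + 1 + 1 + 1 + 1 + 1)) ?_ (by
        rw [Nat.add_mul]; omega)
    refine .loop_step hV (Nat.succ_ne_zero _) ?_
    unfold readClause
    refine .step (.asg hV (Nat.ofDigits (base h) (1 :: D)) ?_ ?_ ?_)
    · rw [Nat.ofDigits_cons]
      exact (Nat.add_comm _ _).trans (congrArg _ (Nat.mul_comm _ _))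
    · exact ofDigits_le (two_le_base h) hD' (by simp only [List.length_cons]; omega) hX
    refine .step (.ld hV p cl.length rfl (tailMem_cons_self p _ _) (by omega) ?_)
    refine .step (.st hV p 0 rfl rfl ?_)
    rw [update_tailMem]
    refine .step (.asg hV (p + 1) rfl (by omega) ?_)
    refine .seq (readLiterals_runs hV hB hX cl (1 :: D) (p + 1) _ _ _ _ _ _ hcl.2 hD' (by omega)
      (by simp only [List.length_cons]; omega) ?_)
    intro a b c d e
    refine .asg hV cs.length rfl (by omega) ?_
    exact ih _ _ _ _ _ _ _ _ _
      (fun c hc => hcs c (by simp [hc])) hdig (by omega) (by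
        simp only [List.length_append, List.length_reverse, List.length_map, List.length_cons]
        omega) H

/-! ### Writing lists of edges -/

/-- The memory that contains the list `out`. -/
def memOf (out : List ℕ) (i : ℕ) : ℕ := out.getD i 0

theorem update_memOf (out : List ℕ) (x : ℕ) :
    Function.update (memOf out) out.length x = memOf (out ++ [x]) := by
  funext i
  rcases lt_trichotomy i out.length with h | h | h
  · rw [Function.update_of_ne h.ne]
    simp [memOf, List.getElem?_append_left h]
  · subst h; simp [memOf]
  · rw [Function.update_of_ne h.ne']
    have : (out ++ [x]).length ≤ i := by simp; omega
    simp [memOf, List.getElem?_eq_none h.le, List.getElem?_eq_none this]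

/-- Append the values of the expressions to the list in the memory, whose length is in
register `4`. -/
def pushAll : List Ex → Cmd
  | [] => .skip
  | e :: es => st (var 4) e ;; asg 4 (var 4 + 1) ;; pushAll es

/-- The expressions must not depend on register `4`, because it changes while they are being
written. -/
theorem pushAll_runs (hV : 2 ≤ V) {L : List ℕ} (hL : L.length = 14)
    {Q : List ℕ → (ℕ → ℕ) → Prop} (es : List Ex) :
    ∀ out : List ℕ, (∀ e ∈ es, (e.Ok ∧ e.size ≤ 24) ∧ ∀ v, e.val (L.set 4 v) = e.val L) →
      out.length + es.length ≤ V →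
      Q (L.set 4 (out ++ es.map (Ex.val L)).length) (memOf (out ++ es.map (Ex.val L))) →
      Runs V (pushAll es) (2 * es.length + 1) (L.set 4 out.length) (memOf out) Q := by
  induction es with
  | nil => intro out _ _ H; exact .skip (by simpa using H)
  | cons e es ih =>
    intro out hes hlen H
    simp only [List.length_cons] at hlen ⊢
    have h4 : (var 4).val (L.set 4 out.length) = out.length := by simp [val, hL]
    have he := hes e (by simp)
    refine .mono (T₁ := 2 * es.length + 1 + 1 + 1) ?_ (by omega)
    refine .step (.st hV out.length (e.val L) h4 (he.2 _) ?_ ⟨by decide, he.1⟩)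
    rw [update_memOf]
    refine .step (.asg hV (out ++ [e.val L]).length ?_ ?_ ?_)
    · rw [List.length_append]; exact congrArg (· + 1) h4
    · simp; omega
    rw [List.set_set]
    refine ih _ (fun e h => hes e (by simp [h])) (by simp; omega) ?_
    simpa using H

/-- The cells that describe an edge: its end points, followed by the weight `1` if `wt`. -/
def arcCells (wt : Bool) (e : ℕ × ℕ) : List ℕ := [e.1, e.2] ++ if wt then [1] else []

/-- The cells that describe an edge, or the two directed edges that replace it if `dir`. -/
def edgeCells (dir wt : Bool) (e : ℕ × ℕ) : List ℕ :=
  arcCells wt e ++ if dir then arcCells wt e.swap else []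

theorem length_edgeCells_le (dir wt : Bool) (e : ℕ × ℕ) : (edgeCells dir wt e).length ≤ 6 := by
  cases dir <;> cases wt <;> simp [edgeCells, arcCells]

def arcExs (wt : Bool) (a b : ℕ) : List Ex := [var a, var b] ++ if wt then [1] else []

def emit (dir wt : Bool) (a b : ℕ) : Cmd :=
  pushAll (arcExs wt a b ++ if dir then arcExs wt b a else [])

theorem emit_runs (hV : 2 ≤ V) (dir wt : Bool) {L : List ℕ} (hL : L.length = 14)
    {Q : List ℕ → (ℕ → ℕ) → Prop} {a b : ℕ} (x y : ℕ) {out : List ℕ} (hx : L.getD a 0 = x)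
    (hy : L.getD b 0 = y) (hlen : out.length + 6 ≤ V)
    (H : Q (L.set 4 (out ++ edgeCells dir wt (x, y)).length)
      (memOf (out ++ edgeCells dir wt (x, y))))
    (ha : a < 20 ∧ a ≠ 4 := by decide) (hb : b < 20 ∧ b ≠ 4 := by decide) :
    Runs V (emit dir wt a b) 13 (L.set 4 out.length) (memOf out) Q := by
  have hvar : ∀ i, i < 20 ∧ i ≠ 4 → ((var i).Ok ∧ (var i).size ≤ 24) ∧
      ∀ v, (var i).val (L.set 4 v) = (var i).val L := fun i hi =>
    ⟨⟨hi.1, by simp [size]⟩, fun v => by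
      simp [val, List.getElem?_set_ne hi.2.symm]⟩
  have hlit : ((1 : Ex).Ok ∧ (1 : Ex).size ≤ 24) ∧
    ∀ v, (1 : Ex).val (L.set 4 v) = (1 : Ex).val L := ⟨by decide, fun _ => rfl⟩
  have hax : (var a).val L = x := hx
  have hby : (var b).val L = y := hy
  have h1 : (1 : Ex).val L = 1 := rfl
  have hva := hvar a ha
  have hvb := hvar b hb
  unfold emit
  refine .mono (pushAll_runs hV hL _ out ?_ ?_ ?_) ?_
  · cases dir <;> cases wt <;> simp only [arcExs] <;> simp [hva, hvb, hlit]
  · cases dir <;> cases wt <;> simp [arcExs] <;> omega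
  · have e : (arcExs wt a b ++ if dir then arcExs wt b a else []).map (Ex.val L) =
        edgeCells dir wt (x, y) := by
      cases dir <;> cases wt <;> simp [arcExs, edgeCells, arcCells, hax, hby, h1]
    rwa [e]
  · cases dir <;> cases wt <;> simp [arcExs]

/-! ### The edges at a partial assignment -/

/-- The edges at the vertex `w`, which has the bit mask `Z` and lies on side `s`, to the vertices
`j, j + 1, …` that belong to the clauses with digits `D`. -/
def rowEdges (w Z s : ℕ) : List ℕ → ℕ → ℕ → List (ℕ × ℕ)
  | [], _, _ => []
  | d :: D, j, flag =>
    if d ≤ 1 then (w, if flag = 0 then j else j + 1 + s) :: rowEdges w Z s D (j + 3) 0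
    else rowEdges w Z s D j (flag + Z / (d / 2) % 2)

/-- Register `7` is the unread part of the formula, `9` the digit split off, `5` the half
assignment, `10` its mask, `11` its side, `6` the shared vertex of the current clause, and `8`
counts the satisfied literals of the clause so far. Only a clause mark writes an edge. The constant
`3` is written as `2 + 1` because `Ok` admits only literals that are at most `V` whenever `2 ≤ V`.
-/
def writeDigit (dir wt : Bool) : Cmd :=
  asg 9 (var 7 - var 2 * (var 7 / var 2)) ;; asg 7 (var 7 / var 2) ;; asg 12 (var 9 - 1) ;;
  .ite 12 (asg 8 (var 8 + (var 10 / (var 9 / 2) - 2 * (var 10 / (var 9 / 2) / 2))))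
    (asg 12 (var 6) ;; .ite 8 (asg 12 (var 6 + 1 + var 11)) .skip ;;
      emit dir wt 5 12 ;; asg 6 (var 6 + 2 + 1) ;; asg 8 0)

/-- No digit is zero, so register `7` vanishes exactly when all digits have been used; this makes it
a valid loop condition. -/
theorem writeDigits_runs (hV : 2 ≤ V) (dir wt : Bool) {N M B F w Z s u : ℕ} (hB : 2 ≤ B)
    {Q : List ℕ → (ℕ → ℕ) → Prop} (D : List ℕ) :
    ∀ (j flag d t : ℕ) (out : List ℕ), (∀ x ∈ D, 0 < x ∧ x < B) →
      flag + D.length ≤ V → j + 3 * D.length + s ≤ V → out.length + 6 * D.length ≤ V →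
      (∀ j' flag' d t out', out' = out ++ (rowEdges w Z s D j flag).flatMap (edgeCells dir wt) →
        Q [N, M, B, F, out'.length, w, j', 0, flag', d, Z, s, t, u] (memOf out')) →
      Runs V (.loop 7 (writeDigit dir wt)) (D.length * 25 + 1)
        [N, M, B, F, out.length, w, j, Nat.ofDigits B D, flag, d, Z, s, t, u] (memOf out) Q := by
  induction D with
  | nil =>
    intro j flag d t out _ _ _ _ H
    exact .mono (.loop_exit hV rfl (H _ _ _ _ out (by simp [rowEdges]))) (Nat.le_add_left _ _)
  | cons x D ih =>
    intro j flag d t out hD hflag hj hout H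
    refine Runs.of_le fun hL => ?_
    have hGV : Nat.ofDigits B (x :: D) ≤ V := hL _ (by simp)
    obtain ⟨hx0, hxB⟩ := hD x (by simp)
    have hD' : ∀ x ∈ D, 0 < x ∧ x < B := fun y hy => hD y (by simp [hy])
    have hG : Nat.ofDigits B (x :: D) = x + B * Nat.ofDigits B D := Nat.ofDigits_cons ..
    have hdiv : Nat.ofDigits B (x :: D) / B = Nat.ofDigits B D := by
      rw [hG, Nat.add_mul_div_left _ _ (by omega), Nat.div_eq_of_lt hxB, zero_add]
    generalize Nat.ofDigits B (x :: D) = G at hG hdiv hGV ⊢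
    have hdivV : Nat.ofDigits B D ≤ V := hdiv ▸ (Nat.div_le_self _ _).trans hGV
    simp only [List.length_cons] at hflag hj hout ⊢
    refine .mono (T₁ := D.length * 25 + 1 + (21 + 1 + 1 + 1 + 1)) ?_ (by omega)
    refine .loop_step hV (show G ≠ 0 by omega) ?_
    unfold writeDigit
    refine .step (.asg hV x (?_ : G - B * (G / B) = x) (by omega) ?_)
    · rw [hdiv]; omega
    refine .step (.asg hV _ hdiv hdivV ?_)
    refine .step (.asg hV (x - 1) rfl (by omega) ?_)
    refine .ite (T := 20) hV (fun hc => ?_) fun hc => ?_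
    · have hc : x - 1 ≠ 0 := hc
      have hlt : Z / (x / 2) % 2 < 2 := Nat.mod_lt _ (by norm_num)
      refine .mono (.asg hV (flag + Z / (x / 2) % 2) ?_ (by omega) ?_) (by norm_num : 1 ≤ 20)
      · refine congrArg (flag + ·) (?_ : Z / (x / 2) - 2 * (Z / (x / 2) / 2) = _)
        omega
      refine ih _ _ _ _ _ hD' (by omega) (by omega) (by omega) ?_
      simpa [rowEdges, show ¬ x ≤ 1 by omega] using H
    · have hc : x - 1 = 0 := hc
      obtain ⟨b, hb⟩ : ∃ b, b = if flag = 0 then j else j + 1 + s := ⟨_, rfl⟩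
      have hH : Runs V (emit dir wt 5 12 ;; asg 6 (var 6 + 2 + 1) ;; asg 8 0) 15
          [N, M, B, F, out.length, w, j, Nat.ofDigits B D, flag, x, Z, s, b, u] (memOf out)
          fun L' m' => Runs V (.loop 7 (writeDigit dir wt)) (D.length * 25 + 1) L' m' Q := by
        refine .seq (T₁ := 13) (emit_runs hV dir wt
          (L := [N, M, B, F, 0, w, j, Nat.ofDigits B D, flag, x, Z, s, b, u]) rfl w b rfl rfl
          (by omega) ?_)
        refine .step (.asg hV (j + 3) rfl (by omega) ?_)
        refine .asg hV 0 rfl (by omega) ?_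
        have := length_edgeCells_le dir wt (w, b)
        refine ih _ _ _ _ _ hD' (by omega) (by omega)
          (by simp only [List.length_append]; omega) ?_
        rw [hb]
        simpa [rowEdges, show x ≤ 1 by omega] using H
      refine .mono (T₁ := 15 + 2 + 1) ?_ (by norm_num)
      refine .step (.asg hV j rfl (by omega) ?_)
      refine .seq (T₁ := 2) (.ite hV (fun h0 => .asg hV b ?_ ?_ hH) fun h0 => .skip ?_)
      · have h0 : flag ≠ 0 := h0
        exact (hb.trans (if_neg h0)).symm
      · rw [hb]; split_ifs <;> omega
      · have h0 : flag = 0 := h0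
        rw [if_pos h0] at hb
        exact hb ▸ hH

/-! ### All edges of the graph -/

/-- The bit mask of the partial assignment `w`: bit `i` is the value of the variable `i`, the
following bits are the negated values; the bits of the second half of the assignments are shifted. -/
def mask (N w : ℕ) : ℕ := (w % N + N * (N - 1 - w % N)) * if w / N = 0 then 1 else N * N

/-- The edges at the vertices below `w`. -/
def rows (N M : ℕ) (D : List ℕ) : ℕ → List (ℕ × ℕ)
  | 0 => []
  | w + 1 => rowEdges w (mask N w) (w / N) D (2 * N) 0 ++ (w, 2 * N + 3 * M + w / N) :: rows N M D w

/-- The edges between the vertex `2 N + 3 M + 1` and the first `i` vertices from `2 N` on. -/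
def hubEdges (N M : ℕ) : ℕ → List (ℕ × ℕ)
  | 0 => []
  | i + 1 => (2 * N + i, 2 * N + 3 * M + 1) :: hubEdges N M i

theorem length_rowEdges_le (w Z s : ℕ) (D : List ℕ) :
    ∀ j flag, (rowEdges w Z s D j flag).length ≤ D.length := by
  induction D with
  | nil => intro j flag; simp [rowEdges]
  | cons d D ih =>
    intro j flag
    rw [rowEdges]
    by_cases hd : d ≤ 1
    · rw [if_pos hd]; exact Nat.succ_le_succ (ih _ _)
    · rw [if_neg hd]; exact (ih _ _).trans (Nat.le_succ _)

theorem length_rows_le (N M : ℕ) (D : List ℕ) (w : ℕ) :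
    (rows N M D w).length ≤ w * (D.length + 1) := by
  induction w with
  | zero => simp [rows]
  | succ w ih =>
    have := length_rowEdges_le w (mask N w) (w / N) D (2 * N) 0
    simp only [rows, List.length_append, List.length_cons, add_one_mul]
    omega

theorem length_flatMap_edgeCells_le (dir wt : Bool) (E : List (ℕ × ℕ)) :
    (E.flatMap (edgeCells dir wt)).length ≤ 6 * E.length := by
  induction E with
  | nil => simp
  | cons e E ih =>
    have := length_edgeCells_le dir wt e
    simp only [List.flatMap_cons, List.length_append, List.length_cons]
    omega

theorem mask_le {N w : ℕ} (hN : 0 < N) : mask N w ≤ N * N * (N * N) := by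
  unfold mask
  have hx : w % N < N := Nat.mod_lt _ hN
  generalize w % N = x at hx
  obtain ⟨y, rfl⟩ : ∃ y, N = x + y + 1 := ⟨N - 1 - x, by omega⟩
  have e : x + y + 1 - 1 - x = y := by omega
  rw [e]
  have h1 : x + (x + y + 1) * y ≤ (x + y + 1) * (x + y + 1) := by nlinarith
  refine Nat.mul_le_mul h1 ?_
  split_ifs
  · exact Nat.mul_pos hN hN
  · rfl

/-- The formula is copied from register `3` to `7`, since reading it destroys the copy. The last
edge leads to the hub of the side on which the assignment lies. -/
def writeRow (dir wt : Bool) : Cmd :=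
  asg 5 (var 5 - 1) ;; asg 11 (var 5 / var 0) ;; asg 9 (var 5 - var 0 * var 11) ;;
  asg 10 (var 9 + var 0 * (var 0 - 1 - var 9)) ;;
  .ite 11 (asg 10 (var 10 * (var 0 * var 0))) .skip ;;
  asg 7 (var 3) ;; asg 6 (2 * var 0) ;; asg 8 0 ;; .loop 7 (writeDigit dir wt) ;;
  asg 12 (2 * var 0 + (2 + 1) * var 1 + var 11) ;; emit dir wt 5 12

theorem writeRows_runs (hV : 2 ≤ V) (dir wt : Bool) {N M B : ℕ} (hN : 0 < N) (hB : 2 ≤ B)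
    (hNV : N * N * (N * N) ≤ V) {D : List ℕ} (hD : ∀ x ∈ D, 0 < x ∧ x < B) (hDV : D.length ≤ V)
    (hDM : 2 * N + 3 * D.length + 1 ≤ V) (hM : 2 * N + 3 * M + 1 ≤ V)
    {Q : List ℕ → (ℕ → ℕ) → Prop} (w : ℕ) :
    ∀ (j G flag d Z s t u : ℕ) (out : List ℕ), w ≤ 2 * N →
      out.length + 6 * (w * (D.length + 1)) ≤ V →
      (∀ j G flag d Z s t out', out' = out ++ (rows N M D w).flatMap (edgeCells dir wt) →
        Q [N, M, B, Nat.ofDigits B D, out'.length, 0, j, G, flag, d, Z, s, t, u] (memOf out')) →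
      Runs V (.loop 5 (writeRow dir wt)) (w * (D.length * 25 + 30) + 1)
        [N, M, B, Nat.ofDigits B D, out.length, w, j, G, flag, d, Z, s, t, u] (memOf out) Q := by
  induction w with
  | zero =>
    intro j G flag d Z s t u out _ _ H
    exact .mono (.loop_exit hV rfl (H _ _ _ _ _ _ _ out (by simp [rows]))) (Nat.le_add_left _ _)
  | succ w ih =>
    intro j G flag d Z s t u out hw hout H
    refine Runs.of_le fun hL => ?_
    have hF : Nat.ofDigits B D ≤ V := hL _ (by simp)
    have hwV : w + 1 ≤ V := hL _ (by simp)
    have hs : w / N < 2 := (Nat.div_lt_iff_lt_mul hN).2 (by omega)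
    have hx : w % N < N := Nat.mod_lt _ hN
    have hmod : w - N * (w / N) = w % N := by have := Nat.mod_add_div w N; omega
    have hmaskV : mask N w ≤ V := (mask_le hN).trans hNV
    have hmask : mask N w = (w % N + N * (N - 1 - w % N)) * if w / N = 0 then 1 else N * N := rfl
    have hpre : w % N + N * (N - 1 - w % N) ≤ V :=
      (Nat.le_mul_of_pos_right _ (by split_ifs; exacts [one_pos, Nat.mul_pos hN hN])).trans
        (hmask.symm.le.trans hmaskV)
    have hrow := length_rowEdges_le w (mask N w) (w / N) D (2 * N) 0
    have hcells := length_flatMap_edgeCells_le dir wt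
      (rowEdges w (mask N w) (w / N) D (2 * N) 0)
    have hout' : out.length + 6 * (w * (D.length + 1)) + 6 * D.length + 6 ≤ V := by
      rw [add_one_mul] at hout; omega
    have hH : Runs V (asg 7 (var 3) ;; asg 6 (2 * var 0) ;; asg 8 0 ;;
        .loop 7 (writeDigit dir wt) ;; asg 12 (2 * var 0 + (2 + 1) * var 1 + var 11) ;;
        emit dir wt 5 12) (13 + 1 + (D.length * 25 + 1) + 1 + 1 + 1)
        [N, M, B, Nat.ofDigits B D, out.length, w, j, G, flag, w % N, mask N w, w / N, t, u]
        (memOf out) fun L' m' =>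
          Runs V (.loop 5 (writeRow dir wt)) (w * (D.length * 25 + 30) + 1) L' m' Q := by
      refine .step (.asg hV _ rfl hF ?_)
      refine .step (.asg hV (2 * N) rfl (by omega) ?_)
      refine .step (.asg hV 0 rfl (by omega) ?_)
      refine .seq (writeDigits_runs hV dir wt hB D _ _ _ _ _ hD (by omega) (by omega) (by omega) ?_)
      intro j flag d t out₁ ho₁
      have hl₁ : out₁.length ≤ out.length + 6 * D.length := by
        rw [ho₁, List.length_append]; omega
      refine .step (.asg hV (2 * N + 3 * M + w / N) rfl (by omega) ?_)
      refine emit_runs hV dir wt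
        (L := [N, M, B, Nat.ofDigits B D, 0, w, j, 0, flag, d, mask N w, w / N,
          2 * N + 3 * M + w / N, u]) rfl w (2 * N + 3 * M + w / N) rfl rfl (by omega) ?_
      have := length_edgeCells_le dir wt (w, 2 * N + 3 * M + w / N)
      refine ih _ _ _ _ _ _ _ _ _ (by omega) (by simp only [List.length_append]; omega) ?_
      intro j G flag d Z s t out₂ ho₂
      exact H _ _ _ _ _ _ _ _ (by rw [ho₂, ho₁]; simp [rows])
    refine .mono (T₁ := w * (D.length * 25 + 30) + 1 +
      (13 + 1 + (D.length * 25 + 1) + 1 + 1 + 1 + 2 + 1 + 1 + 1 + 1 + 1)) ?_ (by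
        rw [add_one_mul]; omega)
    refine .loop_step hV (Nat.succ_ne_zero w) ?_
    unfold writeRow
    refine .step (.asg hV w rfl (by omega) ?_)
    refine .step (.asg hV (w / N) rfl (by omega) ?_)
    refine .step (.asg hV (w % N) hmod (by omega) ?_)
    refine .step (.asg hV (w % N + N * (N - 1 - w % N)) rfl hpre ?_)
    refine .seq (T₁ := 2) (.ite hV (fun hc => .asg hV (mask N w) ?_ hmaskV hH) fun hc => .skip ?_)
    · have hc : w / N ≠ 0 := hc
      rw [hmask, if_neg hc]
      rfl
    · have hc : w / N = 0 := hc
      rw [if_pos hc, mul_one] at hmask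
      rw [hmask] at hH
      exact hH

def writeHub (dir wt : Bool) : Cmd :=
  asg 5 (var 5 - 1) ;; asg 12 (2 * var 0 + var 5) ;; emit dir wt 12 6

theorem writeHubs_runs (hV : 2 ≤ V) (dir wt : Bool) {N M B F G flag d Z s u : ℕ}
    {Q : List ℕ → (ℕ → ℕ) → Prop} (i : ℕ) :
    ∀ (t : ℕ) (out : List ℕ), 2 * N + i ≤ V → out.length + 6 * i ≤ V →
      (∀ t out', out' = out ++ (hubEdges N M i).flatMap (edgeCells dir wt) →
        Q [N, M, B, F, out'.length, 0, 2 * N + 3 * M + 1, G, flag, d, Z, s, t, u] (memOf out')) →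
      Runs V (.loop 5 (writeHub dir wt)) (i * 16 + 1)
        [N, M, B, F, out.length, i, 2 * N + 3 * M + 1, G, flag, d, Z, s, t, u] (memOf out) Q := by
  induction i with
  | zero =>
    intro t out _ _ H
    exact .mono (.loop_exit hV rfl (H _ out (by simp [hubEdges]))) (Nat.le_add_left _ _)
  | succ i ih =>
    intro t out hi hout H
    refine .mono (T₁ := i * 16 + 1 + (13 + 1 + 1 + 1)) ?_ (by omega)
    refine .loop_step hV (Nat.succ_ne_zero i) ?_
    unfold writeHub
    refine .step (.asg hV i rfl (by omega) ?_)
    refine .step (.asg hV (2 * N + i) rfl (by omega) ?_)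
    refine emit_runs hV dir wt
      (L := [N, M, B, F, 0, i, 2 * N + 3 * M + 1, G, flag, d, Z, s, 2 * N + i, u]) rfl (2 * N + i)
      (2 * N + 3 * M + 1) rfl rfl (by omega) ?_
    have := length_edgeCells_le dir wt (2 * N + i, 2 * N + 3 * M + 1)
    refine ih _ _ (by omega) (by simp only [List.length_append]; omega) ?_
    intro t out₂ ho₂
    exact H _ _ (by rw [ho₂]; simp [hubEdges])

/-! ### The reduction program -/

def readFormula : Cmd :=
  ld 7 0 ;; ld 1 1 ;; st 0 0 ;; st 1 0 ;; asg 9 ((var 7 + 1) / 2) ;; asg 10 (var 9) ;; asg 8 1 ;;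
  powLoop ;; asg 0 (var 8) ;; asg 2 (2 * var 0 * var 0 * var 0 * var 0) ;; asg 4 2 ;;
  asg 5 (var 1) ;; readClauses

/-- The number of edges has to be written before the edges. It is known in advance because every
half assignment has exactly one edge per clause, whether or not it satisfies the clause. -/
def writeGraph (dir wt : Bool) : Cmd :=
  asg 4 0 ;; asg 5 (2 * var 0 + (2 + 1) * var 1 + 2) ;;
  asg 12 ((2 * var 0 * (var 1 + 1) + (2 + 1) * var 1 + 1) * if dir then 2 else 1) ;;
  pushAll [var 5, var 12] ;; asg 5 (2 * var 0) ;; .loop 5 (writeRow dir wt) ;;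
  asg 6 (2 * var 0 + (2 + 1) * var 1 + 1) ;; asg 5 ((2 + 1) * var 1 + 1) ;;
  .loop 5 (writeHub dir wt)

/-- A bound for all numbers that the reduction handles, for formulas with `n` variables and `M`
clauses of length at most `k`. -/
def sizeBound (n M k : ℕ) : ℕ :=
  (n + 1) * (100 * (base ((n + 1) / 2) ^ (M * (k + 1) + 1) * (M * (k + 1) + 1)))

theorem length_clauseCells_le {k : ℕ} {cs : List (List ℕ)} (h : ∀ c ∈ cs, c.length ≤ k) :
    (clauseCells cs).length ≤ cs.length * (k + 1) := by
  induction cs with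
  | nil => simp [clauseCells]
  | cons c cs ih =>
    have h1 := ih fun c hc => h c (by simp [hc])
    have h2 := h c (by simp)
    have e : (clauseCells (c :: cs)).length = c.length + 1 + (clauseCells cs).length := by
      simp [clauseCells]; omega
    rw [e, List.length_cons, add_one_mul]
    omega

theorem length_pushClauses (h : ℕ) (cs : List (List ℕ)) :
    ∀ D, (pushClauses h cs D).length = (clauseCells cs).length + D.length := by
  induction cs with
  | nil => intro D; simp [pushClauses, clauseCells]
  | cons c cs ih =>
    intro D
    rw [pushClauses, ih]
    simp [clauseCells]; omega

theorem pushClauses_lt {h : ℕ} (cs : List (List ℕ)) (hcs : ∀ c ∈ cs, ∀ l ∈ c, l < 4 * h) :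
    ∀ x ∈ pushClauses h cs [], 0 < x ∧ x < base h := by
  have h2 := two_le_base h
  intro x hx
  simp only [pushClauses_eq, List.append_nil, List.mem_flatMap, List.mem_reverse, List.mem_append,
    List.mem_map, List.mem_singleton] at hx
  obtain ⟨c, hc, ⟨l, hl, rfl⟩ | rfl⟩ := hx
  · exact ⟨by unfold litDigit; positivity, litDigit_lt (hcs c hc l hl)⟩
  · omega

/-- What the choice of `V` has to guarantee: `base_pow_le` is for the packed formula, `pow_le` for
the masks, and `mul_le` for the addresses of the written graph. -/
structure SizeBounds (V n M k h : ℕ) : Prop where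
  two_le : 2 ≤ V
  n_le : 2 * n + 2 ≤ V
  base_le : base h ≤ V
  base_pow_le : base h ^ (M * (k + 1)) ≤ V
  pow_le : 2 ^ h * 2 ^ h * (2 ^ h * 2 ^ h) ≤ V
  mul_le : 100 * (2 ^ h * (M * (k + 1) + 1)) ≤ V

theorem sizeBounds (n M k : ℕ) : SizeBounds (sizeBound n M k) n M k ((n + 1) / 2) := by
  unfold sizeBound
  generalize (n + 1) / 2 = h
  have hb := two_le_base h
  have hY : base h ≤ base h ^ (M * (k + 1) + 1) := Nat.le_self_pow (by omega) _
  have hY' : base h ^ (M * (k + 1)) ≤ base h ^ (M * (k + 1) + 1) :=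
    Nat.pow_le_pow_right (by omega) (by omega)
  have hN : 2 ^ h * 2 ^ h * (2 ^ h * 2 ^ h) ≤ base h := by
    have : base h = 2 * (2 ^ h * 2 ^ h * (2 ^ h * 2 ^ h)) := by unfold base; ring
    omega
  have hN1 : 2 ^ h ≤ 2 ^ h * 2 ^ h * (2 ^ h * 2 ^ h) := by
    have := Nat.one_le_two_pow (n := h)
    exact (Nat.le_mul_of_pos_right _ (by positivity)).trans
      (Nat.le_mul_of_pos_right _ (by positivity))
  generalize base h ^ (M * (k + 1) + 1) = Y at *
  have hX1 : 1 ≤ M * (k + 1) + 1 := by omega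
  obtain ⟨X, hX⟩ : ∃ X, X = M * (k + 1) + 1 := ⟨_, rfl⟩
  rw [← hX] at hX1 ⊢
  have h1 : Y * 1 ≤ Y * X := Nat.mul_le_mul_left _ hX1
  have h2 : 2 ^ h * X ≤ Y * X := Nat.mul_le_mul_right _ (by omega)
  have h3 : 1 * (100 * (Y * X)) ≤ (n + 1) * (100 * (Y * X)) := Nat.mul_le_mul_right _ (by omega)
  have h4 : (n + 1) * 2 ≤ (n + 1) * (100 * (Y * X)) := Nat.mul_le_mul_left _ (by omega)
  exact ⟨by omega, by omega, by omega, by omega, by omega, by rw [← hX]; omega⟩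

theorem readFormula_runs {V n k h : ℕ} {cs : List (List ℕ)} (hh : h = (n + 1) / 2)
    (hV : SizeBounds V n cs.length k h)
    (hcs : ∀ c ∈ cs, c.length ≤ k ∧ ∀ l ∈ c, l < 2 * n) {Q : List ℕ → (ℕ → ℕ) → Prop}
    (H : ∀ p a b c d h' e f g, Q [2 ^ h, cs.length, base h,
      Nat.ofDigits (base h) (pushClauses h cs []), p, 0, a, b, c, d, h', e, f, g] fun _ => 0) :
    Runs V readFormula (cs.length * (k * (6 * h + 17) + 7) + 3 * h + 13)
      (List.replicate 14 0) (memOf (n :: cs.length :: clauseCells cs)) Q := by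
  have hlen := length_clauseCells_le fun c hc => (hcs c hc).1
  have h2 := hV.two_le
  have hn := hV.n_le
  have hB := hV.base_le
  have hX := hV.base_pow_le
  have hN1 := Nat.one_le_two_pow (n := h)
  have hNX : 2 ^ h * (cs.length * (k + 1) + 1) ≥ 1 * (cs.length * (k + 1) + 1) :=
    Nat.mul_le_mul_right _ hN1
  have hNX' : 2 ^ h * (cs.length * (k + 1) + 1) ≥ 2 ^ h * 1 :=
    Nat.mul_le_mul_left _ (by omega)
  have hMX : cs.length * (k + 1) ≥ cs.length * 1 := Nat.mul_le_mul_left _ (by omega)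
  have hmul := hV.mul_le
  have hM : cs.length ≤ V := by omega
  have hhV : h ≤ V := by omega
  have hm : memOf (n :: cs.length :: clauseCells cs) =
      tailMem 0 (n :: cs.length :: clauseCells cs) := by funext i; simp [memOf, tailMem]
  rw [hm]
  refine .mono (T₁ := cs.length * (k * (6 * h + 17) + 7) + 1 + 1 + 1 + 1 + 1 + (3 * h + 1) + 1 + 1
    + 1 + 1 + 1 + 1 + 1) ?_ (by omega)
  unfold readFormula
  refine .step (.ld h2 0 n rfl (tailMem_cons_self 0 _ _) (by omega) ?_)
  refine .step (.ld h2 1 cs.length rfl rfl hM ?_)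
  refine .step (.st h2 0 0 rfl rfl ?_)
  rw [update_tailMem]
  refine .step (.st h2 1 0 rfl rfl ?_)
  rw [update_tailMem]
  refine .step (.asg h2 h hh.symm hhV ?_)
  refine .step (.asg h2 h rfl hhV ?_)
  refine .step (.asg h2 1 rfl (by omega) ?_)
  refine .seq (powLoop_runs h2 h 1 (by omega) ?_)
  rw [one_mul]
  refine .step (.asg h2 (2 ^ h) rfl (by omega) ?_)
  refine .step (.asg h2 (base h) rfl hB ?_)
  refine .step (.asg h2 2 rfl h2 ?_)
  refine .step (.asg h2 cs.length rfl hM ?_)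
  refine readClauses_runs h2 hB hX cs [] 2 _ _ _ _ _ _ _ ?_ (by simp) (by omega) (by simpa) ?_
  · intro c hc
    refine ⟨(hcs c hc).1, fun l hl => ?_⟩
    have := (hcs c hc).2 l hl
    omega
  · intro p a b c d e f g
    exact H _ _ _ _ _ _ _ _ _

/-- The edges of the graph that belongs to a formula with `M` clauses, whose digits are `D`. -/
def graphEdges (N M : ℕ) (D : List ℕ) : List (ℕ × ℕ) :=
  rows N M D (2 * N) ++ hubEdges N M (3 * M + 1)

/-- The input for a graph algorithm that belongs to a formula. -/
def graphCells (dir wt : Bool) (N M : ℕ) (D : List ℕ) : List ℕ :=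
  [2 * N + 3 * M + 2, (2 * N * (M + 1) + 3 * M + 1) * if dir then 2 else 1] ++
    (graphEdges N M D).flatMap (edgeCells dir wt)

theorem writeGraph_runs {V n M k h : ℕ} (hV : SizeBounds V n M k h) (dir wt : Bool) {D : List ℕ}
    (hD : ∀ x ∈ D, 0 < x ∧ x < base h) (hDX : D.length ≤ M * (k + 1))
    {a₀ a₁ a₂ a₃ a₄ a₅ a₆ a₇ a₈ a₉ : ℕ} {Q : List ℕ → (ℕ → ℕ) → Prop}
    (H : ∀ l, Q (2 ^ h :: l) (memOf (graphCells dir wt (2 ^ h) M D))) :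
    Runs V (writeGraph dir wt)
      (2 * 2 ^ h * (M * (k + 1) * 25 + 30) + 48 * M + 29)
      [2 ^ h, M, base h, Nat.ofDigits (base h) D, a₀, a₁, a₂, a₃, a₄, a₅, a₆, a₇, a₈, a₉]
      (fun _ => 0) Q := by
  have h2 := hV.two_le
  have hn := hV.n_le
  have hB := hV.base_le
  have hX := hV.base_pow_le
  have hmul := hV.mul_le
  have hN1 := Nat.one_le_two_pow (n := h)
  have hpow := hV.pow_le
  have hb2 := two_le_base h
  have hMX : M * 1 ≤ M * (k + 1) := Nat.mul_le_mul_left _ (by omega)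
  -- With the powers and products treated as atoms, all remaining size conditions are linear.
  generalize 2 ^ h = N at *
  generalize M * (k + 1) = X at *
  have hNX : 1 * (X + 1) ≤ N * (X + 1) := Nat.mul_le_mul_right _ hN1
  have hNX' : N * 1 ≤ N * (X + 1) := Nat.mul_le_mul_left _ (by omega)
  have hND : N * (D.length + 1) ≤ N * (X + 1) := Nat.mul_le_mul_left _ (by omega)
  have hNM : N * (M + 1) ≤ N * (X + 1) := Nat.mul_le_mul_left _ (by omega)
  have hND' : 2 * N * (D.length + 1) = 2 * (N * (D.length + 1)) := by ring
  have hNM' : 2 * N * (M + 1) = 2 * (N * (M + 1)) := by ring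
  have hT : 2 * N * (D.length * 25 + 30) ≤ 2 * N * (X * 25 + 30) :=
    Nat.mul_le_mul_left _ (by omega)
  obtain ⟨E, hE⟩ : ∃ E, E = (2 * N * (M + 1) + 3 * M + 1) * if dir then 2 else 1 := ⟨_, rfl⟩
  have hEV : E ≤ V := by rw [hE]; split_ifs <;> omega
  refine .mono (T₁ := (3 * M + 1) * 16 + 1 + 1 + 1 + (2 * N * (D.length * 25 + 30) + 1) + 1 +
    5 + 1 + 1 + 1) ?_ (by omega)
  unfold writeGraph
  refine .step (.asg h2 0 rfl (by omega) ?_)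
  refine .step (.asg h2 (2 * N + 3 * M + 2) rfl (by omega) ?_)
  refine .step (.asg h2 E ?_ hEV ?_ (by decide) (by cases dir <;> decide))
  · rw [hE]; cases dir <;> rfl
  have hm : (fun _ => 0) = memOf [] := by funext i; simp [memOf]
  rw [hm]
  refine .seq (T₁ := 5) (pushAll_runs h2 (L := [N, M, base h, Nat.ofDigits (base h) D, 0,
    2 * N + 3 * M + 2, a₂, a₃, a₄, a₅, a₆, a₇, E, a₉]) rfl [var 5, var 12] [] ?_ ?_ ?_)
  · intro e he
    simp only [List.mem_cons, List.not_mem_nil, or_false] at he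
    rcases he with rfl | rfl <;> exact ⟨by decide, fun _ => rfl⟩
  · simp; omega
  have e : [] ++ [var 5, var 12].map (Ex.val [N, M, base h, Nat.ofDigits (base h) D, 0,
      2 * N + 3 * M + 2, a₂, a₃, a₄, a₅, a₆, a₇, E, a₉]) = [2 * N + 3 * M + 2, E] := rfl
  rw [e]
  refine .step (.asg h2 (2 * N) rfl (by omega) ?_)
  refine .seq (writeRows_runs h2 dir wt (by omega) hb2 hpow hD (by omega) (by omega) (by omega)
    (2 * N) _ _ _ _ _ _ _ _ _ le_rfl ?_ ?_)
  · rw [hND']; simp; omega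
  intro j G flag d Z s t out' ho'
  refine .step (.asg h2 (2 * N + 3 * M + 1) rfl (by omega) ?_)
  refine .step (.asg h2 (3 * M + 1) rfl (by omega) ?_)
  refine writeHubs_runs h2 dir wt (3 * M + 1) _ _ (by omega) ?_ ?_
  · have h1 := length_rows_le N M D (2 * N)
    have h3 := length_flatMap_edgeCells_le dir wt (rows N M D (2 * N))
    rw [hND'] at h1
    rw [ho', List.length_append]
    simp only [List.length_cons, List.length_nil]
    omega
  intro t out'' ho''
  have : out'' = graphCells dir wt N M D := by
    rw [ho'', ho', graphCells, graphEdges, hE]; simp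
  rw [this]
  exact H _

/-! ### Using a program for eccentricities as a subroutine -/

/-- On the values `2` and `3`, truncated subtraction of `2` gives `0` and `1`, so register `8`
counts the right assignments of eccentricity `3`. -/
def scanLoop : Cmd :=
  .loop 5 (asg 5 (var 5 - 1) ;; ld 9 (var 0 + var 5) ;; asg 8 (var 8 + (var 9 - 2)))

/-- Decide whether one of the cells `N, …, 2 N - 1` contains `3`, given that they contain `2`
or `3`. -/
def scan : Cmd := asg 5 (var 0) ;; asg 8 0 ;; scanLoop ;; .ite 8 (st 0 1) (st 0 0)

theorem scanLoop_runs {V : ℕ} (hV : 3 ≤ V) {N a₁ a₂ a₃ a₄ a₆ a₇ b₀ b₁ b₂ b₃ : ℕ} {m : ℕ → ℕ}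
    {Q : List ℕ → (ℕ → ℕ) → Prop} (w : ℕ) :
    ∀ c d : ℕ, c + w ≤ V → (∀ y < w, m (N + y) = 2 ∨ m (N + y) = 3) →
      (∀ c' d, (c' = 0 ↔ c = 0 ∧ ∀ y < w, m (N + y) = 2) →
        Q [N, a₁, a₂, a₃, a₄, 0, a₆, a₇, c', d, b₀, b₁, b₂, b₃] m) →
      Runs V scanLoop (4 * w + 1) [N, a₁, a₂, a₃, a₄, w, a₆, a₇, c, d, b₀, b₁, b₂, b₃] m Q := by
  have h2 : 2 ≤ V := by omega
  induction w with
  | zero => intro c d _ _ H; exact .loop_exit h2 rfl (H _ _ (by simp))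
  | succ w ih =>
    intro c d hc hm H
    refine .mono (T₁ := 4 * w + 1 + (3 + 1)) ?_ (by omega)
    have hw := hm w (by omega)
    refine .loop_step h2 (Nat.succ_ne_zero w) ?_
    refine .step (.asg h2 w rfl (by omega) ?_)
    refine .step (.ld h2 (N + w) (m (N + w)) rfl rfl (by omega) ?_)
    refine .asg h2 (c + (m (N + w) - 2)) rfl (by omega) ?_
    refine ih _ _ (by omega) (fun y hy => hm y (by omega)) fun c' d h => H _ _ (h.trans ?_)
    constructor
    · rintro ⟨h1, h3⟩
      refine ⟨by omega, fun y hy => ?_⟩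
      rcases Nat.lt_succ_iff_lt_or_eq.1 hy with h | rfl
      · exact h3 y h
      · omega
    · rintro ⟨h1, h3⟩
      have := h3 w (by omega)
      exact ⟨by omega, fun y hy => h3 y (by omega)⟩

theorem scan_runs {V : ℕ} (hV : 3 ≤ V) {N : ℕ} {l : List ℕ} (hl : (N :: l).length = 14)
    {m : ℕ → ℕ} (hm : ∀ y < N, m (N + y) = 2 ∨ m (N + y) = 3) :
    Runs V scan (4 * N + 5) (N :: l) m fun _ m' =>
      ((∃ y < N, m (N + y) = 3) → m' 0 = 1) ∧ ((¬ ∃ y < N, m (N + y) = 3) → m' 0 = 0) := by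
  refine Runs.of_le fun hL => ?_
  have h2 : 2 ≤ V := by omega
  have hN : N ≤ V := hL _ (by simp)
  match l, hl with
  | [a₁, a₂, a₃, a₄, a₅, a₆, a₇, a₈, a₉, b₀, b₁, b₂, b₃], _ =>
  refine .mono (T₁ := 2 + (4 * N + 1) + 1 + 1) ?_ (by omega)
  refine .step (.asg h2 N rfl hN ?_)
  refine .step (.asg h2 0 rfl (by omega) ?_)
  refine .seq (scanLoop_runs hV N 0 _ (by omega) hm ?_)
  intro c d hc
  refine .ite h2 (fun h => .st h2 0 1 rfl rfl ?_) fun h => .st h2 0 0 rfl rfl ?_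
  · have h : c ≠ 0 := h
    refine ⟨fun _ => by simp, fun h3 => absurd ?_ h⟩
    refine hc.2 ⟨rfl, fun y hy => (hm y hy).resolve_right fun h4 => h3 ⟨y, hy, h4⟩⟩
  · have h : c = 0 := h
    refine ⟨?_, fun _ => by simp⟩
    rintro ⟨y, hy, h3⟩
    have := (hc.1 h).2 y hy
    omega

/-- Decide satisfiability by means of the program `p` for eccentricities. -/
def reduction (dir wt : Bool) (p : Cmd) : Cmd :=
  readFormula ;; writeGraph dir wt ;; p.shift 70 ;; scan

/-- The number of ticks that the reduction takes in addition to the time of the subroutine. -/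
def overhead (h M k : ℕ) : ℕ :=
  2 * 2 ^ h * (M * (k + 1) * 25 + 30) + 48 * M + 29 + (M * (k * (6 * h + 17) + 7) + 3 * h + 13) +
    (4 * 2 ^ h + 5)

theorem matches_init {V : ℕ} (input : List ℕ) :
    Matches V (List.replicate 14 0) (memOf input) (init input) where
  length := rfl
  le x hx := by simp [List.eq_of_mem_replicate hx]
  reg i _ := by
    rw [List.getD_eq_getElem?_getD, List.getElem?_replicate]
    split_ifs <;> rfl
  mem := rfl

theorem reduction_exec (dir wt : Bool) {p : Cmd} {n k h : ℕ} {cs : List (List ℕ)}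
    (hh : h = (n + 1) / 2) (hcs : ∀ c ∈ cs, c.length ≤ k ∧ ∀ l ∈ c, l < 2 * n) {t : ℕ} {s : State}
    (hp : Exec p (init (graphCells dir wt (2 ^ h) cs.length (pushClauses h cs []))) t s)
    (hs : ∀ y < 2 ^ h, s.mem (2 ^ h + y) = 2 ∨ s.mem (2 ^ h + y) = 3) :
    ∃ t' s', Exec (reduction dir wt p) (init (n :: cs.length :: clauseCells cs)) t' s' ∧
      t' ≤ t + overhead h cs.length k * tick (sizeBound n cs.length k) ∧
      ((∃ y < 2 ^ h, s.mem (2 ^ h + y) = 3) → s'.mem 0 = 1) ∧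
      ((¬ ∃ y < 2 ^ h, s.mem (2 ^ h + y) = 3) → s'.mem 0 = 0) := by
  have hV := sizeBounds n cs.length k
  rw [← hh] at hV
  have hV3 : 3 ≤ sizeBound n cs.length k := by
    have := hV.mul_le
    have : 0 < 2 ^ h * (cs.length * (k + 1) + 1) := by positivity
    omega
  have hD : (pushClauses h cs []).length ≤ cs.length * (k + 1) := by
    rw [length_pushClauses]
    simpa using length_clauseCells_le fun c hc => (hcs c hc).1
  have hlt := pushClauses_lt cs fun c hc l hl => by
    have := (hcs c hc).2 l hl
    show l < 4 * h
    omega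
  obtain ⟨t₁, S₁, L₁, m₁, e₁, ht₁, M₁, ⟨⟨l, rfl⟩, rfl⟩, f₁⟩ :=
    Runs.seq (p := readFormula) (q := writeGraph dir wt)
      (Q := fun L m => (∃ l, L = 2 ^ h :: l) ∧
        m = memOf (graphCells dir wt (2 ^ h) cs.length (pushClauses h cs [])))
      (readFormula_runs hh hV hcs fun p a b c d h' e f g =>
        writeGraph_runs hV dir wt hlt hD fun l => ⟨⟨l, rfl⟩, rfl⟩)
      (init (n :: cs.length :: clauseCells cs)) (matches_init _)
  -- The registers from `70` on are still zero and the memory is exactly the encoded graph, so the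
  -- renamed subroutine sees its own initial configuration.
  have hsim : ShiftSim 70 S₁ (init (graphCells dir wt (2 ^ h) cs.length (pushClauses h cs []))) S₁ :=
    ⟨fun i => f₁ _ (by omega), M₁.mem, fun _ _ => rfl⟩
  obtain ⟨S₂, e₂, h₂⟩ := hp.shift hsim
  -- The subroutine does not touch the low registers, so register `0` still contains `2 ^ h`. Of its
  -- final memory, only the cells of the right assignments matter.
  obtain ⟨t₃, S₃, L₃, m₃, e₃, ht₃, M₃, hQ, -⟩ := scan_runs hV3 M₁.length hs S₂
    ⟨M₁.length, M₁.le, fun i hi => by rw [h₂.low i (by omega), M₁.reg i hi], h₂.mem⟩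
  cases e₁ with
  | seq e e' =>
    refine ⟨_, S₃, .seq e (.seq e' (.seq e₂ e₃)), ?_, ?_⟩
    · unfold overhead
      rw [add_mul]
      omega
    · rw [M₃.mem]; exact hQ

/-! ### The edges of the reduction graph -/

/-- The edges at `w` for the clauses with literal digits `Ds`. -/
def clauseEdges (w Z s : ℕ) : List (List ℕ) → ℕ → List (ℕ × ℕ)
  | [], _ => []
  | l :: Ds, j => (w, if (l.map fun d => Z / (d / 2) % 2).sum = 0 then j else j + 1 + s) ::
      clauseEdges w Z s Ds (j + 3)

/-- Literal digits only add their bits to the flag; the mark `1` emits the edge and resets the flag.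
-/
theorem rowEdges_append (w Z s : ℕ) (l D : List ℕ) (hl : ∀ d ∈ l, 1 < d) :
    ∀ j flag, rowEdges w Z s (l ++ 1 :: D) j flag =
      (w, if flag + (l.map fun d => Z / (d / 2) % 2).sum = 0 then j else j + 1 + s) ::
        rowEdges w Z s D (j + 3) 0 := by
  induction l with
  | nil => intro j flag; simp [rowEdges]
  | cons d l ih =>
    intro j flag
    have hd := hl d (by simp)
    rw [List.cons_append, rowEdges, if_neg (by omega), ih fun d hd => hl d (by simp [hd])]
    simp [add_assoc]

theorem rowEdges_eq_clauseEdges (w Z s : ℕ) (Ds : List (List ℕ))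
    (hDs : ∀ l ∈ Ds, ∀ d ∈ l, 1 < d) :
    ∀ j, rowEdges w Z s (Ds.flatMap fun l => l ++ [1]) j 0 = clauseEdges w Z s Ds j := by
  induction Ds with
  | nil => intro j; rfl
  | cons l Ds ih =>
    intro j
    have : (l :: Ds).flatMap (fun l => l ++ [1]) = l ++ 1 :: Ds.flatMap fun l => l ++ [1] := by simp
    rw [this, rowEdges_append _ _ _ _ _ (hDs l (by simp)), ih fun l hl => hDs l (by simp [hl]),
      clauseEdges, zero_add]

/-- The bits of `Z` that belong to the digits in `l` are not all zero. -/
def Hit (Z : ℕ) (l : List ℕ) : Prop := ∃ d ∈ l, Z / (d / 2) % 2 = 1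

theorem sum_bits_eq_zero (Z : ℕ) (l : List ℕ) :
    (l.map fun d => Z / (d / 2) % 2).sum = 0 ↔ ¬ Hit Z l := by
  rw [List.sum_eq_zero_iff, Hit]
  simp only [List.mem_map, forall_exists_index, and_imp, forall_apply_eq_imp_iff₂, not_exists,
    not_and]
  refine forall₂_congr fun d _ => ?_
  omega

open Classical in
/-- The vertex of clause `i` at which `w` is joined to this clause. -/
noncomputable def target (N : ℕ) (Ds : List (List ℕ)) (w i : ℕ) : ℕ :=
  2 * N + 3 * i + if Hit (mask N w) (Ds.getD i []) then 1 + w / N else 0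

theorem mem_clauseEdges (w Z s : ℕ) (e : ℕ × ℕ) (Ds : List (List ℕ)) : ∀ j,
    e ∈ clauseEdges w Z s Ds j ↔ ∃ i < Ds.length, e = (w, j + 3 * i +
      open Classical in if Hit Z (Ds.getD i []) then 1 + s else 0) := by
  induction Ds with
  | nil => intro j; simp [clauseEdges]
  | cons l Ds ih =>
    intro j
    have key : (if (l.map fun d => Z / (d / 2) % 2).sum = 0 then j else j + 1 + s) =
        j + open Classical in if Hit Z l then 1 + s else 0 := by
      by_cases h : Hit Z l
      · rw [if_neg fun h0 => (sum_bits_eq_zero Z l).1 h0 h, if_pos h, add_assoc]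
      · rw [if_pos ((sum_bits_eq_zero Z l).2 h), if_neg h, add_zero]
    rw [clauseEdges, List.mem_cons, ih, key]
    constructor
    · rintro (rfl | ⟨i, hi, rfl⟩)
      · exact ⟨0, by simp, rfl⟩
      · exact ⟨i + 1, by simpa using hi, by rw [List.getD_cons_succ]; congr 2; ring⟩
    · rintro ⟨_ | i, hi, rfl⟩
      · exact .inl rfl
      · exact .inr ⟨i, by simpa using hi, by rw [List.getD_cons_succ]; congr 2; ring⟩

theorem length_clauseEdges (w Z s : ℕ) (Ds : List (List ℕ)) :
    ∀ j, (clauseEdges w Z s Ds j).length = Ds.length := by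
  induction Ds with
  | nil => intro j; rfl
  | cons l Ds ih => intro j; simp [clauseEdges, ih]

/-- For `s ≤ 1` the offset within a clause is at most `2`, so the blocks of three vertices are
disjoint. -/
theorem nodup_clauseEdges (w Z : ℕ) {s : ℕ} (hs : s ≤ 1) (Ds : List (List ℕ)) :
    ∀ j, (clauseEdges w Z s Ds j).Nodup := by
  induction Ds with
  | nil => intro j; exact List.nodup_nil
  | cons l Ds ih =>
    intro j
    refine List.nodup_cons.2 ⟨fun h => ?_, ih _⟩
    rw [mem_clauseEdges] at h
    obtain ⟨i, _, h⟩ := h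
    rw [Prod.mk.injEq] at h
    split_ifs at h <;> omega

variable {N M : ℕ} {Ds : List (List ℕ)}

/-- The digits of a formula, from the digits of its literals. -/
def allDigits (Ds : List (List ℕ)) : List ℕ := Ds.flatMap fun l => l ++ [1]

theorem rows_succ (hDs : ∀ l ∈ Ds, ∀ d ∈ l, 1 < d) (w : ℕ) :
    rows N M (allDigits Ds) (w + 1) = clauseEdges w (mask N w) (w / N) Ds (2 * N) ++
      (w, 2 * N + 3 * M + w / N) :: rows N M (allDigits Ds) w := by
  rw [rows, allDigits, rowEdges_eq_clauseEdges _ _ _ _ hDs]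

theorem mem_rows (hDs : ∀ l ∈ Ds, ∀ d ∈ l, 1 < d) (hM : Ds.length = M) (e : ℕ × ℕ) (w : ℕ) :
    e ∈ rows N M (allDigits Ds) w ↔ e.1 < w ∧ ((∃ i < M, e.2 = target N Ds e.1 i) ∨
      e.2 = 2 * N + 3 * M + e.1 / N) := by
  induction w with
  | zero => simp [rows]
  | succ w ih =>
    rw [rows_succ hDs, List.mem_append, List.mem_cons, ih, mem_clauseEdges, hM]
    obtain ⟨a, b⟩ := e
    simp only [Prod.mk.injEq]
    constructor
    · rintro (⟨i, hi, rfl, rfl⟩ | ⟨rfl, rfl⟩ | ⟨h, h'⟩)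
      · exact ⟨by omega, .inl ⟨i, hi, rfl⟩⟩
      · exact ⟨by omega, .inr rfl⟩
      · exact ⟨by omega, h'⟩
    · rintro ⟨ha, h⟩
      by_cases haw : a = w
      · subst haw
        rcases h with ⟨i, hi, h⟩ | h
        · exact .inl ⟨i, hi, rfl, h⟩
        · exact .inr (.inl ⟨rfl, h⟩)
      · exact .inr (.inr ⟨by omega, h⟩)

theorem length_rows (hDs : ∀ l ∈ Ds, ∀ d ∈ l, 1 < d) (hM : Ds.length = M) (w : ℕ) :
    (rows N M (allDigits Ds) w).length = w * (M + 1) := by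
  induction w with
  | zero => simp [rows]
  | succ w ih =>
    rw [rows_succ hDs, List.length_append, List.length_cons, ih, length_clauseEdges, hM]
    ring

theorem target_lt {w i : ℕ} (hw : w < 2 * N) (hi : i < M) : target N Ds w i < 2 * N + 3 * M := by
  have : w / N < 2 := Nat.div_lt_of_lt_mul (by omega)
  unfold target
  split_ifs <;> omega

theorem nodup_rows (hDs : ∀ l ∈ Ds, ∀ d ∈ l, 1 < d) (hM : Ds.length = M) (w : ℕ)
    (hw : w ≤ 2 * N) : (rows N M (allDigits Ds) w).Nodup := by
  induction w with
  | zero => simp [rows]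
  | succ w ih =>
    have hs : w / N < 2 := Nat.div_lt_of_lt_mul (by omega)
    rw [rows_succ hDs, List.nodup_append]
    refine ⟨nodup_clauseEdges _ _ (by omega) _ _, List.nodup_cons.2 ⟨fun h => ?_, ih (by omega)⟩, ?_⟩
    · rw [mem_rows hDs hM] at h
      exact absurd h.1 (lt_irrefl w)
    · intro e he e' he' hee
      subst hee
      rw [mem_clauseEdges] at he
      obtain ⟨i, hi, rfl⟩ := he
      rcases List.mem_cons.1 he' with h | h
      · have := target_lt (Ds := Ds) (show w < 2 * N by omega) (hM ▸ hi)
        rw [target] at this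
        rw [(Prod.mk.inj h).2] at this
        exact absurd this (Nat.not_lt.2 (Nat.le_add_right _ _))
      · rw [mem_rows hDs hM] at h
        exact absurd h.1 (lt_irrefl w)

theorem mem_hubEdges (e : ℕ × ℕ) (i : ℕ) :
    e ∈ hubEdges N M i ↔ 2 * N ≤ e.1 ∧ e.1 < 2 * N + i ∧ e.2 = 2 * N + 3 * M + 1 := by
  induction i with
  | zero => simp [hubEdges]; omega
  | succ i ih =>
    rw [hubEdges, List.mem_cons, ih]
    obtain ⟨a, b⟩ := e
    simp only [Prod.mk.injEq]
    omega

theorem length_hubEdges (i : ℕ) : (hubEdges N M i).length = i := by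
  induction i with
  | zero => rfl
  | succ i ih => simp [hubEdges, ih]

theorem nodup_hubEdges (i : ℕ) : (hubEdges N M i).Nodup := by
  induction i with
  | zero => exact List.nodup_nil
  | succ i ih => exact List.nodup_cons.2 ⟨fun h => by rw [mem_hubEdges] at h; omega, ih⟩

theorem mem_graphEdges (hDs : ∀ l ∈ Ds, ∀ d ∈ l, 1 < d) (hM : Ds.length = M) (a b : ℕ) :
    (a, b) ∈ graphEdges N M (allDigits Ds) ↔
      (a < 2 * N ∧ ((∃ i < M, b = target N Ds a i) ∨ b = 2 * N + 3 * M + a / N)) ∨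
      (2 * N ≤ a ∧ a < 2 * N + (3 * M + 1) ∧ b = 2 * N + 3 * M + 1) := by
  rw [graphEdges, List.mem_append, mem_rows hDs hM, mem_hubEdges]

theorem length_graphEdges (hDs : ∀ l ∈ Ds, ∀ d ∈ l, 1 < d) (hM : Ds.length = M) :
    (graphEdges N M (allDigits Ds)).length = 2 * N * (M + 1) + 3 * M + 1 := by
  rw [graphEdges, List.length_append, length_rows hDs hM, length_hubEdges, add_assoc]

theorem nodup_graphEdges (hDs : ∀ l ∈ Ds, ∀ d ∈ l, 1 < d) (hM : Ds.length = M) :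
    (graphEdges N M (allDigits Ds)).Nodup := by
  rw [graphEdges, List.nodup_append]
  refine ⟨nodup_rows hDs hM _ le_rfl, nodup_hubEdges _, ?_⟩
  intro e he e' he' hee
  subst hee
  rw [mem_rows hDs hM] at he
  rw [mem_hubEdges] at he'
  omega

/-- The vertices are numbered in the order assignments, clause vertices, left hub, right hub, and
every listed edge goes up in this order. Hence there are no loops and no edge is listed in both
orientations. -/
theorem graphEdges_lt (hDs : ∀ l ∈ Ds, ∀ d ∈ l, 1 < d) (hM : Ds.length = M) {e : ℕ × ℕ}
    (he : e ∈ graphEdges N M (allDigits Ds)) : e.1 < e.2 ∧ e.2 < 2 * N + 3 * M + 2 := by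
  obtain ⟨a, b⟩ := e
  rw [mem_graphEdges hDs hM] at he
  rcases he with ⟨ha, ⟨i, hi, rfl⟩ | rfl⟩ | h
  · have := target_lt (Ds := Ds) ha hi
    have : 2 * N ≤ target N Ds a i := by unfold target; omega
    dsimp only; omega
  · have : a / N < 2 := Nat.div_lt_of_lt_mul (by omega)
    generalize a / N = s at this
    dsimp only; omega
  · dsimp only; omega

/-! ### Eccentricities in the reduction graph -/

/-- The graph on `n` vertices with the edges in the list `E`. -/
def listGraph (n : ℕ) (E : List (ℕ × ℕ)) : SimpleGraph (Fin n) :=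
  SimpleGraph.fromRel fun a b => ((a : ℕ), (b : ℕ)) ∈ E

theorem listGraph_adj {n : ℕ} {E : List (ℕ × ℕ)} (hE : ∀ e ∈ E, e.1 < e.2) (a b : Fin n) :
    (listGraph n E).Adj a b ↔ ((a : ℕ), (b : ℕ)) ∈ E ∨ ((b : ℕ), (a : ℕ)) ∈ E := by
  rw [listGraph, SimpleGraph.fromRel_adj, and_iff_right_iff_imp]
  rintro h rfl
  have : ((a : ℕ), (a : ℕ)) ∈ E := or_self_iff.1 h
  exact absurd (hE _ this) (lt_irrefl _)

theorem edist_le_two {V : Type*} {G : SimpleGraph V} {a b c : V} (h : G.Adj a b) (h' : G.Adj b c) :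
    G.edist a c ≤ 2 := SimpleGraph.edist_le (.cons h (.cons h' .nil))

theorem edist_le_three {V : Type*} {G : SimpleGraph V} {a b c d : V} (h : G.Adj a b)
    (h' : G.Adj b c) (h'' : G.Adj c d) : G.edist a d ≤ 3 :=
  SimpleGraph.edist_le (.cons h (.cons h' (.cons h'' .nil)))

/-- The graph whose eccentricities decide satisfiability. -/
def reductionGraph (N : ℕ) (Ds : List (List ℕ)) : SimpleGraph (Fin (2 * N + 3 * Ds.length + 2)) :=
  listGraph _ (graphEdges N Ds.length (allDigits Ds))

theorem reductionGraph_adj (hDs : ∀ l ∈ Ds, ∀ d ∈ l, 1 < d)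
    {a b : Fin (2 * N + 3 * Ds.length + 2)} : (reductionGraph N Ds).Adj a b ↔
      ((a : ℕ), (b : ℕ)) ∈ graphEdges N Ds.length (allDigits Ds) ∨
      ((b : ℕ), (a : ℕ)) ∈ graphEdges N Ds.length (allDigits Ds) :=
  listGraph_adj (fun _ he => (graphEdges_lt hDs rfl he).1) a b

/-- Right assignments get this edge from their own row, clause vertices and the left hub from
`hubEdges`. -/
theorem adj_hub (hDs : ∀ l ∈ Ds, ∀ d ∈ l, 1 < d) {a : ℕ} (ha : N ≤ a)
    (ha' : a < 2 * N + 3 * Ds.length + 1) :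
    (reductionGraph N Ds).Adj ⟨a, by omega⟩ ⟨2 * N + 3 * Ds.length + 1, by omega⟩ := by
  rw [reductionGraph_adj hDs, mem_graphEdges hDs rfl]
  left
  by_cases h : a < 2 * N
  · left
    have : a / N = 1 := Nat.div_eq_of_lt_le (by omega) (by omega)
    exact ⟨h, .inr (by rw [this])⟩
  · exact .inr (by dsimp only; omega)

theorem adj_left_hub (hDs : ∀ l ∈ Ds, ∀ d ∈ l, 1 < d) {x : ℕ} (hx : x < N) :
    (reductionGraph N Ds).Adj ⟨x, by omega⟩ ⟨2 * N + 3 * Ds.length, by omega⟩ := by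
  rw [reductionGraph_adj hDs, mem_graphEdges hDs rfl]
  exact .inl (.inl ⟨by dsimp only; omega, .inr (by dsimp only; rw [Nat.div_eq_of_lt hx, add_zero])⟩)

theorem adj_clause (hDs : ∀ l ∈ Ds, ∀ d ∈ l, 1 < d) {w i : ℕ} (hw : w < 2 * N)
    (hi : i < Ds.length) (h : ¬ Hit (mask N w) (Ds.getD i [])) :
    (reductionGraph N Ds).Adj ⟨w, by omega⟩ ⟨2 * N + 3 * i, by omega⟩ := by
  rw [reductionGraph_adj hDs, mem_graphEdges hDs rfl]
  refine .inl (.inl ⟨hw, .inl ⟨i, hi, ?_⟩⟩)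
  rw [target, if_neg h, add_zero]

theorem reductionGraph_connected (hDs : ∀ l ∈ Ds, ∀ d ∈ l, 1 < d) :
    (reductionGraph N Ds).Connected := by
  have key : ∀ a, (reductionGraph N Ds).Reachable a ⟨2 * N + 3 * Ds.length + 1, by omega⟩ := by
    rintro ⟨a, ha⟩
    by_cases h1 : a < N
    · exact (adj_left_hub hDs h1).reachable.trans (adj_hub hDs (by omega) (by omega)).reachable
    · by_cases h2 : a = 2 * N + 3 * Ds.length + 1
      · subst h2; rfl
      · exact (adj_hub hDs (by omega) (by omega)).reachable
  have : Nonempty (Fin (2 * N + 3 * Ds.length + 2)) := ⟨⟨0, by omega⟩⟩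
  exact ⟨fun a b => (key a).trans (key b).symm⟩

/-- Encoding the case distinction by `r ∈ {0, 1}` turns comparisons of targets into linear
arithmetic once the side `w / N` is known. -/
theorem target_eq (w i : ℕ) : ∃ r ≤ 1, target N Ds w i = 2 * N + 3 * i + r * (1 + w / N) ∧
    (r = 0 ↔ ¬ Hit (mask N w) (Ds.getD i [])) := by
  by_cases h : Hit (mask N w) (Ds.getD i [])
  · exact ⟨1, le_rfl, by rw [target, if_pos h, one_mul], iff_of_false one_ne_zero (not_not.2 h)⟩
  · exact ⟨0, zero_le_one, by rw [target, if_neg h, zero_mul], iff_of_true rfl h⟩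

/-- The upper end of every listed edge is at least `2 * N`, so an assignment vertex can only be the
lower end. -/
theorem adj_cases (hDs : ∀ l ∈ Ds, ∀ d ∈ l, 1 < d) {a c : Fin (2 * N + 3 * Ds.length + 2)}
    (ha : (a : ℕ) < 2 * N) (h : (reductionGraph N Ds).Adj a c) :
    (∃ i < Ds.length, (c : ℕ) = target N Ds a i) ∨ (c : ℕ) = 2 * N + 3 * Ds.length + a / N := by
  rw [reductionGraph_adj hDs, mem_graphEdges hDs rfl, mem_graphEdges hDs rfl] at h
  rcases h with (h | h) | ⟨_, ⟨i, _, h⟩ | h⟩ | h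
  · exact h.2
  · omega
  · obtain ⟨r, -, hr, -⟩ := target_eq (N := N) (Ds := Ds) c i
    omega
  · generalize (c : ℕ) / N = q at h
    omega
  · omega

theorem two_lt_edist (hDs : ∀ l ∈ Ds, ∀ d ∈ l, 1 < d) {x y : ℕ} (hx : x < N) (hy : y < N)
    (h : ∀ i < Ds.length, Hit (mask N x) (Ds.getD i []) ∨ Hit (mask N (N + y)) (Ds.getD i [])) :
    2 < (reductionGraph N Ds).edist ⟨N + y, by omega⟩ ⟨x, by omega⟩ := by
  have hyN : (N + y) / N = 1 := Nat.div_eq_of_lt_le (by omega) (by omega)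
  have hxN : x / N = 0 := Nat.div_eq_of_lt hx
  rw [SimpleGraph.two_lt_edist_iff]
  refine ⟨fun h => ?_, fun hadj => ?_, Set.eq_empty_iff_forall_notMem.2 fun c hc => ?_⟩
  · rw [Fin.mk.injEq] at h; omega
  · rcases adj_cases hDs (by dsimp only; omega) hadj with ⟨i, _, hi⟩ | hi
    · obtain ⟨r, -, hr, -⟩ := target_eq (N := N) (Ds := Ds) (N + y) i
      dsimp only at hi
      omega
    · dsimp only at hi
      omega
  · rw [SimpleGraph.mem_commonNeighbors] at hc
    have h1 := adj_cases hDs (by dsimp only; omega) hc.1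
    have h2 := adj_cases hDs (by dsimp only; omega) hc.2
    dsimp only at h1 h2
    rw [hyN] at h1
    rw [hxN] at h2
    rcases h1 with ⟨i, hi, h1⟩ | h1 <;> rcases h2 with ⟨j, hj, h2⟩ | h2
    · obtain ⟨r, hr1, hr, hr0⟩ := target_eq (N := N) (Ds := Ds) (N + y) i
      obtain ⟨q, hq1, hq, hq0⟩ := target_eq (N := N) (Ds := Ds) x j
      rw [hyN] at hr
      rw [hxN] at hq
      -- Within a block of three, right assignments reach the offsets `0` and `2`, left ones `0` and
      -- `1`. A common clause vertex therefore has offset `0` and belongs to a clause that neither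
      -- satisfies.
      obtain rfl : i = j := by omega
      exact (h i hi).elim (hq0.1 (by omega)) (hr0.1 (by omega))
    · have := target_lt (N := N) (Ds := Ds) (w := N + y) (by omega) hi
      omega
    · have := target_lt (N := N) (Ds := Ds) (w := x) (by omega) hj
      omega
    · omega

/-- The route goes through the right hub if `b` is not a left assignment, and otherwise through the
shared vertex of a clause that neither half satisfies. -/
theorem edist_right_le_two (hDs : ∀ l ∈ Ds, ∀ d ∈ l, 1 < d) {y : ℕ} (hy : y < N)
    (b : Fin (2 * N + 3 * Ds.length + 2)) (hb : N ≤ (b : ℕ) ∨ ∃ i < Ds.length,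
      ¬ Hit (mask N b) (Ds.getD i []) ∧ ¬ Hit (mask N (N + y)) (Ds.getD i [])) :
    (reductionGraph N Ds).edist ⟨N + y, by omega⟩ b ≤ 2 := by
  obtain ⟨b, hb'⟩ := b
  by_cases h1 : b < N
  · obtain ⟨i, hi, hx, hr⟩ := hb.resolve_left (Nat.not_le.2 h1)
    have hx : ¬ Hit (mask N b) (Ds.getD i []) := hx
    exact edist_le_two (adj_clause hDs (by omega) hi hr) (adj_clause hDs (by omega) hi hx).symm
  · have h := adj_hub hDs (show N ≤ N + y by omega) (by omega)
    by_cases h2 : b = 2 * N + 3 * Ds.length + 1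
    · subst h2
      exact (SimpleGraph.edist_le h.toWalk).trans (by simp)
    · exact edist_le_two h (adj_hub hDs (by omega) (by omega)).symm

theorem eccent_reductionGraph (hDs : ∀ l ∈ Ds, ∀ d ∈ l, 1 < d) {y : ℕ} (hy : y < N) :
    ((reductionGraph N Ds).eccent ⟨N + y, by omega⟩ = 2 ∨
      (reductionGraph N Ds).eccent ⟨N + y, by omega⟩ = 3) ∧
    ((reductionGraph N Ds).eccent ⟨N + y, by omega⟩ = 3 ↔
      ∃ x < N, ∀ i < Ds.length, Hit (mask N x) (Ds.getD i []) ∨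
        Hit (mask N (N + y)) (Ds.getD i [])) := by
  have h3 : (reductionGraph N Ds).eccent ⟨N + y, by omega⟩ ≤ 3 := by
    refine iSup_le fun b => ?_
    by_cases hb : N ≤ (b : ℕ)
    · exact (edist_right_le_two hDs hy b (.inl hb)).trans (by norm_num : (2 : ℕ∞) ≤ 3)
    · exact edist_le_three (adj_hub hDs (by omega) (by omega))
        (adj_hub hDs (a := 2 * N + 3 * Ds.length) (by omega) (by omega)).symm
        (adj_left_hub hDs (show (b : ℕ) < N by omega)).symm
  have h2 : 2 ≤ (reductionGraph N Ds).eccent ⟨N + y, by omega⟩ := by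
    -- Vertex `0` is a left assignment, hence neither equal nor adjacent to a right one.
    refine le_trans ?_ (SimpleGraph.edist_le_eccent (v := ⟨0, by omega⟩))
    by_contra h
    have h : (reductionGraph N Ds).edist ⟨N + y, by omega⟩ ⟨0, by omega⟩ ≤ 1 :=
      Order.le_of_lt_add_one (by simpa [one_add_one_eq_two] using h)
    rw [SimpleGraph.edist_le_one_iff_adj_or_eq, Fin.mk.injEq] at h
    rcases h with hadj | h
    · rcases adj_cases hDs (by dsimp only; omega) hadj with ⟨i, _, hi⟩ | hi
      · obtain ⟨r, -, hr, -⟩ := target_eq (N := N) (Ds := Ds) (N + y) i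
        have hi : 0 = target N Ds (N + y) i := hi
        omega
      · have hi : 0 = 2 * N + 3 * Ds.length + (N + y) / N := hi
        generalize (N + y) / N = q at hi
        omega
    · omega
  by_cases hex : ∃ x < N, ∀ i < Ds.length, Hit (mask N x) (Ds.getD i []) ∨
      Hit (mask N (N + y)) (Ds.getD i [])
  · obtain ⟨x, hx, h⟩ := id hex
    have := (two_lt_edist hDs hx hy h).trans_le SimpleGraph.edist_le_eccent
    have h4 := le_antisymm h3 (by simpa [two_add_one_eq_three] using Order.add_one_le_of_lt this)
    exact ⟨.inr h4, iff_of_true h4 hex⟩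
  · have h4 : (reductionGraph N Ds).eccent ⟨N + y, by omega⟩ ≤ 2 := by
      refine iSup_le fun b => edist_right_le_two hDs hy b ?_
      by_contra hb
      push Not at hb
      refine hex ⟨b, hb.1, fun i hi => ?_⟩
      by_contra hh
      push Not at hh
      exact hh.2 (hb.2 i hi hh.1)
    have h4 := le_antisymm h4 h2
    exact ⟨.inl h4, iff_of_false (by rw [h4]; norm_num) hex⟩

/-! ### Satisfiability in terms of partial assignments -/

/-- `2 ^ h - 1 - x` is the bitwise complement of `x`. The lower block of `h` bits thus answers
positive literals, the upper block negative ones. -/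
theorem testBit_half {h x : ℕ} (hx : x < 2 ^ h) (j : ℕ) :
    (x + 2 ^ h * (2 ^ h - 1 - x)).testBit j =
      if j < h then x.testBit j else (decide (j - h < h) && !x.testBit (j - h)) := by
  rw [Nat.add_comm, Nat.testBit_two_pow_mul_add _ hx, show 2 ^ h - 1 - x = 2 ^ h - (x + 1) by omega,
    Nat.testBit_two_pow_sub_succ hx]

theorem mask_bit_left {h x l : ℕ} (hx : x < 2 ^ h) :
    mask (2 ^ h) x / 2 ^ litPos h l % 2 = 1 ↔
      l / 2 < h ∧ x.testBit (l / 2) = decide (l % 2 = 1) := by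
  have e : mask (2 ^ h) x = x + 2 ^ h * (2 ^ h - 1 - x) := by
    rw [mask, Nat.mod_eq_of_lt hx, Nat.div_eq_of_lt hx, if_pos rfl, mul_one]
  have : (mask (2 ^ h) x / 2 ^ litPos h l % 2 = 1) = ((mask (2 ^ h) x).testBit (litPos h l)) := by
    rw [Nat.testBit_eq_decide_div_mod_eq, decide_eq_true_eq]
  rw [this, e, testBit_half hx]
  unfold litPos
  rcases Nat.mod_two_eq_zero_or_one l with h2 | h2 <;> by_cases h1 : l / 2 < h <;>
    simp [h1, h2]

/-- The factor `2 ^ (h + h)` empties the lowest `2 h` bits, which are those asked for by literals of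
the first half. In `mask_bit_left` it is the bits from `2 h` on that vanish. -/
theorem mask_bit_right {h y l : ℕ} (hy : y < 2 ^ h) (hl : l / 2 < 2 * h) :
    mask (2 ^ h) (2 ^ h + y) / 2 ^ litPos h l % 2 = 1 ↔
      h ≤ l / 2 ∧ y.testBit (l / 2 - h) = decide (l % 2 = 1) := by
  have hN := Nat.one_le_two_pow (n := h)
  have e : mask (2 ^ h) (2 ^ h + y) = (y + 2 ^ h * (2 ^ h - 1 - y)) * 2 ^ (h + h) := by
    have hd : (2 ^ h + y) / 2 ^ h = 1 := Nat.div_eq_of_lt_le (by omega) (by omega)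
    rw [mask, hd, if_neg one_ne_zero, Nat.add_mod_left, Nat.mod_eq_of_lt hy, pow_add]
  have : (mask (2 ^ h) (2 ^ h + y) / 2 ^ litPos h l % 2 = 1) =
      ((mask (2 ^ h) (2 ^ h + y)).testBit (litPos h l)) := by
    rw [Nat.testBit_eq_decide_div_mod_eq, decide_eq_true_eq]
  rw [this, e, Nat.testBit_mul_two_pow, testBit_half hy]
  unfold litPos
  rcases Nat.mod_two_eq_zero_or_one l with h2 | h2 <;> by_cases h1 : l / 2 < h
  · simp [h1, h2]
  · have e₁ : ¬ l / 2 + h + h - (h + h) < h := by omega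
    have e₂ : h + h ≤ l / 2 + h + h := by omega
    have e₃ : l / 2 + h + h - (h + h) - h = l / 2 - h := by omega
    have e₄ : l / 2 - h < h := by omega
    simp [h1, h2, e₁, e₂, e₃, e₄, not_lt.1 h1]
  · have e₁ : ¬ h ≤ l / 2 := not_le.2 h1
    have e₂ : ¬ h + h ≤ l / 2 := by omega
    simp [h1, h2, e₁, e₂]
  · have e₁ : l / 2 + 0 + h - (h + h) < h := by omega
    have e₂ : h + h ≤ l / 2 + 0 + h := by omega
    have e₃ : l / 2 + 0 + h - (h + h) = l / 2 - h := by omega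
    rw [e₃] at e₁
    simp only [h1, h2, one_ne_zero, if_false, e₁, e₂, e₃, if_true, not_lt.1 h1]
    simp

/-- The digits of the literals of every clause, for the clauses in reverse order. -/
def literalDigits (h : ℕ) (cs : List (List ℕ)) : List (List ℕ) :=
  cs.reverse.map fun c => (c.map (litDigit h)).reverse

theorem pushClauses_eq_allDigits (h : ℕ) (cs : List (List ℕ)) :
    pushClauses h cs [] = allDigits (literalDigits h cs) := by
  rw [pushClauses_eq, List.append_nil, allDigits, literalDigits, List.flatMap_map]

theorem one_lt_of_mem_literalDigits {h : ℕ} {cs : List (List ℕ)} :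
    ∀ l ∈ literalDigits h cs, ∀ d ∈ l, 1 < d := by
  intro l hl d hd
  simp only [literalDigits, List.mem_map] at hl
  obtain ⟨c, _, rfl⟩ := hl
  simp only [List.mem_reverse, List.mem_map] at hd
  obtain ⟨l, _, rfl⟩ := hd
  have := Nat.one_le_two_pow (n := litPos h l)
  unfold litDigit
  omega

theorem forall_getD_literalDigits {h : ℕ} {cs : List (List ℕ)} {P : List ℕ → Prop} :
    (∀ i < (literalDigits h cs).length, P ((literalDigits h cs).getD i [])) ↔
      ∀ c ∈ cs, P (c.map (litDigit h)).reverse := by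
  have : (∀ i < (literalDigits h cs).length, P ((literalDigits h cs).getD i [])) ↔
      ∀ l ∈ literalDigits h cs, P l := by
    rw [List.forall_mem_iff_forall_getElem]
    refine forall₂_congr fun i hi => ?_
    rw [List.getD_eq_getElem _ _ hi]
  rw [this]
  simp [literalDigits]

theorem hit_iff (Z h : ℕ) (c : List ℕ) : Hit Z (c.map (litDigit h)).reverse ↔
    ∃ l ∈ c, Z / 2 ^ litPos h l % 2 = 1 := by
  simp [Hit, litDigit]

/-- Half assignments `x`, `y` satisfy all clauses. -/
theorem hit_or_hit_iff {h x y : ℕ} (hx : x < 2 ^ h) (hy : y < 2 ^ h) {τ : ℕ → Bool}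
    (hτ : ∀ i < h, τ i = x.testBit i) (hτ' : ∀ i < h, τ (h + i) = y.testBit i) {c : List ℕ}
    (hc : ∀ l ∈ c, l / 2 < 2 * h) :
    (Hit (mask (2 ^ h) x) (c.map (litDigit h)).reverse ∨
      Hit (mask (2 ^ h) (2 ^ h + y)) (c.map (litDigit h)).reverse) ↔
    ∃ l ∈ c, τ (l / 2) = decide (l % 2 = 1) := by
  rw [hit_iff, hit_iff, ← exists_or]
  refine exists_congr fun l => ?_
  rw [← and_or_left]
  refine and_congr_right fun hl => ?_
  rw [mask_bit_left hx, mask_bit_right hy (hc l hl)]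
  by_cases h1 : l / 2 < h
  · simp [h1, hτ _ h1]
  · have := hτ' (l / 2 - h) (by have := hc l hl; omega)
    rw [show h + (l / 2 - h) = l / 2 by omega] at this
    simp [h1, this, not_lt.1 h1]

theorem encodeLiteral_div {n : ℕ} (l : Literal n) : KCNF.encodeLiteral l / 2 = l.1 := by
  unfold KCNF.encodeLiteral; split_ifs <;> omega

theorem encodeLiteral_mod {n : ℕ} (l : Literal n) :
    decide (KCNF.encodeLiteral l % 2 = 1) = l.2 := by
  unfold KCNF.encodeLiteral
  cases l.2 <;> simp

/-- The clauses of a formula as lists of numbers. -/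
def codes {k : ℕ} (φ : KCNF k) : List (List ℕ) := φ.clauses.map (List.map KCNF.encodeLiteral)

/-- An assignment is cut into two numbers by its bits, and conversely. Variables from `φ.n` to `2 *
h - 1` occur in no clause, so their values are irrelevant. -/
theorem satisfiable_iff {k : ℕ} (φ : KCNF k) {h : ℕ} (hh : φ.n ≤ 2 * h) :
    φ.Satisfiable ↔ ∃ x < 2 ^ h, ∃ y < 2 ^ h, ∀ c ∈ codes φ,
      Hit (mask (2 ^ h) x) (c.map (litDigit h)).reverse ∨
      Hit (mask (2 ^ h) (2 ^ h + y)) (c.map (litDigit h)).reverse := by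
  have hc : ∀ c ∈ codes φ, ∀ l ∈ c, l / 2 < 2 * h := by
    intro c hc l hl
    simp only [codes, List.mem_map] at hc
    obtain ⟨c, _, rfl⟩ := hc
    rw [List.mem_map] at hl
    obtain ⟨l, _, rfl⟩ := hl
    rw [encodeLiteral_div]
    omega
  have key : ∀ (σ : Fin φ.n → Bool) (τ : ℕ → Bool), (∀ i, τ (i : Fin φ.n) = σ i) →
      ((∀ c ∈ φ.clauses, ∃ l ∈ c, σ l.1 = l.2) ↔
        ∀ c ∈ codes φ, ∃ l ∈ c, τ (l / 2) = decide (l % 2 = 1)) := by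
    intro σ τ h
    rw [codes, List.forall_mem_map]
    refine forall₂_congr fun c _ => ?_
    simp only [List.mem_map, exists_exists_and_eq_and, encodeLiteral_div, encodeLiteral_mod, h]
  constructor
  · rintro ⟨σ, hσ⟩
    obtain ⟨τ, hτ⟩ : ∃ τ : ℕ → Bool, ∀ i, τ (i : Fin φ.n) = σ i :=
      ⟨fun i => if hi : i < φ.n then σ ⟨i, hi⟩ else false, fun i => by simp⟩
    rw [key σ τ hτ] at hσ
    refine ⟨Nat.ofBits fun i : Fin h => τ i, Nat.ofBits_lt_two_pow _,
      Nat.ofBits fun i : Fin h => τ (h + i), Nat.ofBits_lt_two_pow _, fun c hcc => ?_⟩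
    rw [hit_or_hit_iff (Nat.ofBits_lt_two_pow _) (Nat.ofBits_lt_two_pow _) (τ := τ) ?_ ?_ (hc c hcc)]
    · exact hσ c hcc
    · intro i hi; rw [Nat.testBit_ofBits_lt _ _ hi]
    · intro i hi; rw [Nat.testBit_ofBits_lt _ _ hi]
  · rintro ⟨x, hx, y, hy, hxy⟩
    refine ⟨fun i => if (i : ℕ) < h then x.testBit i else y.testBit (i - h), ?_⟩
    rw [key _ (fun i => if i < h then x.testBit i else y.testBit (i - h)) fun _ => rfl]
    intro c hcc
    refine (hit_or_hit_iff hx hy (τ := fun i => if i < h then x.testBit i else y.testBit (i - h))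
      ?_ ?_ (hc c hcc)).1 ?_
    · intro i hi; simp [hi]
    · intro i hi; simp
    · exact hxy c hcc

/-! ### The four kinds of inputs -/

/-- `E` lists the edges of a connected graph on the vertices `0, …, n - 1`, each from its smaller to
its larger end point. -/
structure EdgeList (n : ℕ) (E : List (ℕ × ℕ)) : Prop where
  two_le : 2 ≤ n
  lt : ∀ e ∈ E, e.1 < e.2 ∧ e.2 < n
  nodup : E.Nodup
  connected : (listGraph n E).Connected

namespace EdgeList

variable {n : ℕ} {E : List (ℕ × ℕ)}

def finEdges (H : EdgeList n E) : List (Fin n × Fin n) :=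
  E.pmap (fun e (h : e.1 < e.2 ∧ e.2 < n) => (⟨e.1, h.1.trans h.2⟩, ⟨e.2, h.2⟩)) H.lt

theorem map_finEdges (H : EdgeList n E) :
    H.finEdges.map (fun e => ((e.1 : ℕ), (e.2 : ℕ))) = E := by
  rw [finEdges, List.map_pmap]
  simp

theorem length_finEdges (H : EdgeList n E) : H.finEdges.length = E.length := by
  rw [finEdges, List.length_pmap]

theorem flatMap_finEdges (H : EdgeList n E) (f : ℕ × ℕ → List ℕ) :
    H.finEdges.flatMap (fun e => f (e.1, e.2)) = E.flatMap f := by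
  conv_rhs => rw [← H.map_finEdges, List.flatMap_map]

theorem nodup_finEdges (H : EdgeList n E) : H.finEdges.Nodup :=
  List.Nodup.of_map _ (H.map_finEdges.symm ▸ H.nodup)

theorem mem_finEdges (H : EdgeList n E) (a b : Fin n) :
    (a, b) ∈ H.finEdges ↔ ((a : ℕ), (b : ℕ)) ∈ E := by
  constructor
  · intro h
    rw [← H.map_finEdges]
    exact List.mem_map_of_mem (f := fun e : Fin n × Fin n => ((e.1 : ℕ), (e.2 : ℕ))) h
  · intro h
    rw [← H.map_finEdges, List.mem_map] at h
    obtain ⟨⟨c, d⟩, hcd, h⟩ := h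
    rw [Prod.mk.injEq, Fin.val_inj, Fin.val_inj] at h
    obtain ⟨rfl, rfl⟩ := h
    exact hcd

theorem lt_of_mem_finEdges (H : EdgeList n E) {e : Fin n × Fin n} (he : e ∈ H.finEdges) :
    e.1 < e.2 := (H.lt _ ((H.mem_finEdges e.1 e.2).1 he)).1

theorem adj_iff (H : EdgeList n E) (a b : Fin n) :
    (listGraph n E).Adj a b ↔ (a, b) ∈ H.finEdges ∨ (b, a) ∈ H.finEdges := by
  rw [listGraph_adj (fun e he => (H.lt e he).1), H.mem_finEdges, H.mem_finEdges]

def undirected (H : EdgeList n E) : UndirectedGraph where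
  n := n
  two_le := H.two_le
  graph := listGraph n E
  connected := H.connected
  edges := H.finEdges
  nodup := by
    refine List.Nodup.map_on (fun e he e' he' h => ?_) H.nodup_finEdges
    rcases Sym2.eq_iff.1 h with ⟨h1, h2⟩ | ⟨h1, h2⟩
    · exact Prod.ext h1 h2
    · have h3 := H.lt_of_mem_finEdges he
      have h4 := H.lt_of_mem_finEdges he'
      rw [h1, h2] at h3
      exact absurd h3 h4.not_gt
  mem_edges e := by
    induction e using Sym2.ind with
    | _ a b =>
      rw [SimpleGraph.mem_edgeSet, H.adj_iff, List.mem_map]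
      constructor
      · rintro ⟨⟨c, d⟩, hcd, h⟩
        rcases Sym2.eq_iff.1 h with ⟨rfl, rfl⟩ | ⟨rfl, rfl⟩
        · exact .inl hcd
        · exact .inr hcd
      · rintro (h | h)
        · exact ⟨_, h, rfl⟩
        · exact ⟨_, h, Sym2.eq_swap⟩

/-- Every arc is followed at once by its reverse, the order in which `edgeCells` writes them. -/
def arcs (H : EdgeList n E) : List (Fin n × Fin n) := H.finEdges.flatMap fun e => [e, e.swap]

theorem mem_arcs (H : EdgeList n E) (a b : Fin n) :
    (a, b) ∈ H.arcs ↔ (a, b) ∈ H.finEdges ∨ (b, a) ∈ H.finEdges := by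
  rw [arcs, List.mem_flatMap]
  constructor
  · rintro ⟨⟨c, d⟩, h, h'⟩
    simp only [Prod.swap_prod_mk, List.mem_cons, Prod.mk.injEq, List.not_mem_nil, or_false] at h'
    rcases h' with ⟨rfl, rfl⟩ | ⟨rfl, rfl⟩
    · exact .inl h
    · exact .inr h
  · rintro (h | h)
    · exact ⟨_, h, by simp⟩
    · exact ⟨_, h, by simp⟩

theorem nodup_arcs (H : EdgeList n E) : H.arcs.Nodup := by
  rw [arcs, List.nodup_flatMap]
  refine ⟨fun e he => ?_, ?_⟩
  · have := H.lt_of_mem_finEdges he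
    simp only [List.nodup_cons, List.mem_singleton, List.not_mem_nil, not_false_eq_true,
      List.nodup_nil, and_true]
    intro h
    rw [Prod.ext_iff] at h
    exact this.ne h.1
  · refine H.nodup_finEdges.pairwise_of_forall_ne fun e he e' he' hne => ?_
    have h3 := H.lt_of_mem_finEdges he
    have h4 := H.lt_of_mem_finEdges he'
    rw [Function.onFun, List.disjoint_left]
    intro x hx hx'
    simp only [List.mem_cons, List.not_mem_nil, or_false] at hx hx'
    rcases hx with rfl | rfl <;> rcases hx' with h | h
    · exact hne h
    · rw [h] at h3; exact absurd h3 h4.not_gt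
    · rw [← h] at h4; exact absurd h3 h4.not_gt
    · exact hne (Prod.swap_injective h)

theorem length_arcs (H : EdgeList n E) : H.arcs.length = E.length * 2 := by
  rw [arcs, List.length_flatMap]
  simp [length_finEdges]

theorem flatMap_arcs (H : EdgeList n E) (f : ℕ × ℕ → List ℕ) :
    H.arcs.flatMap (fun e => f (e.1, e.2)) = E.flatMap fun e => f e ++ f e.swap := by
  rw [arcs, List.flatMap_assoc, ← H.flatMap_finEdges fun e => f e ++ f e.swap]
  simp

def directed (H : EdgeList n E) : DirectedGraph where
  n := n
  two_le := H.two_le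
  graph := { Adj := (listGraph n E).Adj }
  loopless v := (listGraph n E).loopless.irrefl v
  connected u v := (SimpleGraph.reachable_iff_reflTransGen u v).1 (H.connected u v)
  edges := H.arcs
  nodup := H.nodup_arcs
  mem_edges e := (H.mem_arcs e.1 e.2).trans (H.adj_iff e.1 e.2).symm

def weightedUndirected (H : EdgeList n E) (a : ℕ) : WeightedUndirectedGraph a where
  toUndirectedGraph := H.undirected
  weight _ := 1
  weight_pos _ _ := one_pos
  weight_le _ _ := Nat.one_le_pow _ _ (lt_of_lt_of_le two_pos H.two_le)

def weightedDirected (H : EdgeList n E) (a : ℕ) : WeightedDirectedGraph a where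
  toDirectedGraph := H.directed
  weight _ _ := 1
  weight_pos _ _ _ := one_pos
  weight_le _ _ _ := Nat.one_le_pow _ _ (lt_of_lt_of_le two_pos H.two_le)

/-- The input of a graph algorithm, in one of the four versions. -/
def cells (dir wt : Bool) (n : ℕ) (E : List (ℕ × ℕ)) : List ℕ :=
  [n, E.length * if dir then 2 else 1] ++ E.flatMap (edgeCells dir wt)

end EdgeList

/-- The program `p` computes the eccentricities of all connected graphs in time `g`; the Booleans
`dir` and `wt` determine how the graph is written. -/
def ComputesEcc (dir wt : Bool) (p : Cmd) (g : ℕ → ℕ → ℝ) : Prop :=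
  ∀ (n : ℕ) (E : List (ℕ × ℕ)), EdgeList n E → ∃ t s,
    Exec p (init (EdgeList.cells dir wt n E)) t s ∧
    (∀ v : Fin n, (s.mem v : ℕ∞) = (listGraph n E).eccent v) ∧
    (t : ℝ) ≤ g (E.length * if dir then 2 else 1) n

theorem computesEcc_undirected {p : Cmd} {g : ℕ → ℕ → ℝ}
    (h : SolvesWithin p eccUndirected.encode eccUndirected.Correct fun x =>
      g (eccUndirected.numEdges x) (eccUndirected.numVertices x)) :
    ComputesEcc false false p g := by
  intro n E H
  obtain ⟨t, s, h1, h2, h3⟩ := h H.undirected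
  have hc : edgeCells false false = fun e => [e.1, e.2] := rfl
  have e : eccUndirected.encode H.undirected = EdgeList.cells false false n E := by
    simpa [eccUndirected, EdgeList.undirected, EdgeList.cells, H.length_finEdges, hc] using H.flatMap_finEdges fun e => [e.1, e.2]
  rw [e] at h1
  refine ⟨t, s, h1, h2, h3.trans_eq ?_⟩
  simp [eccUndirected, EdgeList.undirected, H.length_finEdges]

/-- With both orientations of every edge, the directed adjacency relation is that of the undirected
graph, so the eccentricities agree. -/
theorem computesEcc_directed {p : Cmd} {g : ℕ → ℕ → ℝ}
    (h : SolvesWithin p eccDirected.encode eccDirected.Correct fun x =>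
      g (eccDirected.numEdges x) (eccDirected.numVertices x)) :
    ComputesEcc true false p g := by
  intro n E H
  obtain ⟨t, s, h1, h2, h3⟩ := h H.directed
  have hc : edgeCells true false = fun e => [e.1, e.2, e.2, e.1] := rfl
  have e : eccDirected.encode H.directed = EdgeList.cells true false n E := by
    simpa [eccDirected, EdgeList.directed, EdgeList.cells, H.length_arcs, hc] using H.flatMap_arcs fun e => [e.1, e.2]
  rw [e] at h1
  refine ⟨t, s, h1, fun v => (h2 v).trans (weccent_one_eq_eccent _ v), h3.trans_eq ?_⟩
  simp [eccDirected, EdgeList.directed, H.length_arcs]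

/-- All weights are `1`, which is admissible for every `a`, including `a = 0`. -/
theorem computesEcc_weightedUndirected {a : ℕ} {p : Cmd} {g : ℕ → ℕ → ℝ}
    (h : SolvesWithin p (eccWeightedUndirected a).encode (eccWeightedUndirected a).Correct fun x =>
      g ((eccWeightedUndirected a).numEdges x) ((eccWeightedUndirected a).numVertices x)) :
    ComputesEcc false true p g := by
  intro n E H
  obtain ⟨t, s, h1, h2, h3⟩ := h (H.weightedUndirected a)
  have hc : edgeCells false true = fun e => [e.1, e.2, 1] := rfl
  have e : (eccWeightedUndirected a).encode (H.weightedUndirected a) =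
      EdgeList.cells false true n E := by
    simpa [eccWeightedUndirected, EdgeList.weightedUndirected, EdgeList.undirected, EdgeList.cells,
      H.length_finEdges, hc] using H.flatMap_finEdges fun e => [e.1, e.2, 1]
  rw [e] at h1
  refine ⟨t, s, h1, fun v => (h2 v).trans (weccent_one_eq_eccent _ v), h3.trans_eq ?_⟩
  simp [eccWeightedUndirected, EdgeList.weightedUndirected, EdgeList.undirected, H.length_finEdges]

theorem computesEcc_weightedDirected {a : ℕ} {p : Cmd} {g : ℕ → ℕ → ℝ}
    (h : SolvesWithin p (eccWeightedDirected a).encode (eccWeightedDirected a).Correct fun x =>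
      g ((eccWeightedDirected a).numEdges x) ((eccWeightedDirected a).numVertices x)) :
    ComputesEcc true true p g := by
  intro n E H
  obtain ⟨t, s, h1, h2, h3⟩ := h (H.weightedDirected a)
  have hc : edgeCells true true = fun e => [e.1, e.2, 1, e.2, e.1, 1] := rfl
  have e : (eccWeightedDirected a).encode (H.weightedDirected a) =
      EdgeList.cells true true n E := by
    simpa [eccWeightedDirected, EdgeList.weightedDirected, EdgeList.directed, EdgeList.cells,
      H.length_arcs, hc] using H.flatMap_arcs fun e => [e.1, e.2, 1]
  rw [e] at h1
  refine ⟨t, s, h1, fun v => (h2 v).trans (weccent_one_eq_eccent _ v), h3.trans_eq ?_⟩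
  simp [eccWeightedDirected, EdgeList.weightedDirected, EdgeList.directed, H.length_arcs]

/-! ### Growth estimates -/

/-- `f` is bounded by a polynomial. -/
def PolyBounded (f : ℕ → ℕ) : Prop := ∃ c d, ∀ n, f n ≤ c * (n + 1) ^ d

namespace PolyBounded

variable {f g : ℕ → ℕ}

theorem const (c : ℕ) : PolyBounded fun _ => c := ⟨c, 0, fun n => by simp⟩

theorem id : PolyBounded fun n => n := ⟨1, 1, fun n => by simp⟩

theorem mono (hg : PolyBounded g) (h : ∀ n, f n ≤ g n) : PolyBounded f := by
  obtain ⟨c, d, hc⟩ := hg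
  exact ⟨c, d, fun n => (h n).trans (hc n)⟩

theorem add (hf : PolyBounded f) (hg : PolyBounded g) : PolyBounded fun n => f n + g n := by
  obtain ⟨c, d, hc⟩ := hf
  obtain ⟨c', d', hc'⟩ := hg
  refine ⟨c + c', d + d', fun n => ?_⟩
  have h1 : c * (n + 1) ^ d ≤ c * (n + 1) ^ (d + d') :=
    Nat.mul_le_mul_left _ (Nat.pow_le_pow_right (by omega) (by omega))
  have h2 : c' * (n + 1) ^ d' ≤ c' * (n + 1) ^ (d + d') :=
    Nat.mul_le_mul_left _ (Nat.pow_le_pow_right (by omega) (by omega))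
  have := hc n
  have := hc' n
  rw [add_mul]
  show f n + g n ≤ _
  omega

theorem mul (hf : PolyBounded f) (hg : PolyBounded g) : PolyBounded fun n => f n * g n := by
  obtain ⟨c, d, hc⟩ := hf
  obtain ⟨c', d', hc'⟩ := hg
  refine ⟨c * c', d + d', fun n => (Nat.mul_le_mul (hc n) (hc' n)).trans_eq ?_⟩
  ring

theorem pow (hf : PolyBounded f) (k : ℕ) : PolyBounded fun n => f n ^ k := by
  induction k with
  | zero => exact const 1
  | succ k ih => exact (ih.mul hf).mono fun n => (pow_succ _ _).le

/-- A polynomially bounded function grows more slowly than every exponential function. -/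
theorem le_two_rpow (hf : PolyBounded f) {ε : ℝ} (hε : 0 < ε) :
    ∃ C : ℝ, 0 ≤ C ∧ ∀ n : ℕ, (f n : ℝ) ≤ C * (2 : ℝ) ^ (ε * n) := by
  obtain ⟨c, d, hc⟩ := hf
  have hr : (1 : ℝ) < 2 ^ ε := Real.one_lt_rpow one_lt_two hε
  have h1 := (isLittleO_pow_const_const_pow_of_one_lt (R := ℝ) d hr).isBigO
  -- The exponential never vanishes, so the asymptotic bound holds for all arguments with a suitable
  -- constant.
  rw [Asymptotics.isBigO_nat_atTop_iff (fun x hx => absurd hx (by positivity))] at h1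
  obtain ⟨C, hC⟩ := h1
  refine ⟨c * (|C| * 2 ^ ε), by positivity, fun n => ?_⟩
  -- The polynomial is one in `n + 1`; the resulting extra factor `2 ^ ε` is part of the constant.
  have h2 := hC (n + 1)
  have h3 : (f n : ℝ) ≤ c * ((n + 1 : ℕ) : ℝ) ^ d := by exact_mod_cast hc n
  have e : (2 : ℝ) ^ (ε * n) = ((2 : ℝ) ^ ε) ^ n := by
    rw [Real.rpow_mul two_pos.le, Real.rpow_natCast]
  refine h3.trans ?_
  rw [mul_assoc]
  refine mul_le_mul_of_nonneg_left ?_ (Nat.cast_nonneg _)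
  rw [e, mul_assoc, ← pow_succ']
  refine (Real.norm_of_nonneg (by positivity)).symm.le.trans (h2.trans ?_)
  rw [Real.norm_of_nonneg (show (0 : ℝ) ≤ ((2 : ℝ) ^ ε) ^ (n + 1) by positivity)]
  exact mul_le_mul_of_nonneg_right (le_abs_self C) (by positivity)

end PolyBounded

/-- The ratio `m / N` lies in `[1, q]`. The exponent may be negative, hence the absolute value. -/
theorem rpow_le_of_between {N q m α : ℝ} (hN : 0 < N) (h1 : N ≤ m) (h2 : m ≤ N * q) :
    m ^ α ≤ N ^ α * q ^ |α| := by
  have hr1 : 1 ≤ m / N := (one_le_div hN).2 h1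
  have hrq : m / N ≤ q := (div_le_iff₀' hN).2 h2
  have e : m = N * (m / N) := by field_simp
  conv_lhs => rw [e]
  rw [Real.mul_rpow hN.le (by linarith)]
  refine mul_le_mul_of_nonneg_left ?_ (by positivity)
  exact (Real.rpow_le_rpow_of_exponent_le hr1 (le_abs_self α)).trans
    (Real.rpow_le_rpow (by linarith) hrq (abs_nonneg α))

/-- A sub-`mn` function for graphs with about `N` vertices and edges, up to a factor `q`. -/
theorem subMN_le {α β γ C : ℝ} (hγ : α + β ≤ γ) {N q m n D : ℕ} (hD : |α| + |β| ≤ D) (hN : 1 ≤ N)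
    (hm : N ≤ m) (hm' : m ≤ N * q) (hn : N ≤ n) (hn' : n ≤ N * q) :
    C * ((m : ℝ) ^ α * (n : ℝ) ^ β) ≤ |C| * ((N : ℝ) ^ γ * (q : ℝ) ^ D) := by
  have hN0 : (0 : ℝ) < N := by exact_mod_cast hN
  have hN1 : (1 : ℝ) ≤ N := by exact_mod_cast hN
  have hq : 1 ≤ q := by
    rcases Nat.eq_zero_or_pos q with rfl | h
    · omega
    · exact h
  have hq1 : (1 : ℝ) ≤ q := by exact_mod_cast hq
  have h1 := rpow_le_of_between (α := α) (q := q) hN0 (Nat.cast_le.2 hm) (by exact_mod_cast hm')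
  have h2 := rpow_le_of_between (α := β) (q := q) hN0 (Nat.cast_le.2 hn) (by exact_mod_cast hn')
  have h3 : (m : ℝ) ^ α * (n : ℝ) ^ β ≤ (N : ℝ) ^ γ * (q : ℝ) ^ D := by
    refine (mul_le_mul h1 h2 (by positivity) (by positivity)).trans ?_
    have e : (N : ℝ) ^ α * (q : ℝ) ^ |α| * ((N : ℝ) ^ β * (q : ℝ) ^ |β|) =
        (N : ℝ) ^ (α + β) * (q : ℝ) ^ (|α| + |β|) := by
      rw [Real.rpow_add hN0, Real.rpow_add (by linarith)]; ring
    rw [e, ← Real.rpow_natCast (q : ℝ) D]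
    exact mul_le_mul (Real.rpow_le_rpow_of_exponent_le hN1 hγ)
      (Real.rpow_le_rpow_of_exponent_le hq1 hD) (by positivity) (by positivity)
  exact (mul_le_mul_of_nonneg_right (le_abs_self C) (by positivity)).trans
    (mul_le_mul_of_nonneg_left h3 (abs_nonneg C))

/-- A list of length at most `k` is determined by its `k` optional entries, and there are `2 n + 1`
optional literals. -/
theorem length_clauses_le {k : ℕ} (φ : KCNF k) : φ.clauses.length ≤ (2 * φ.n + 1) ^ k := by
  have hinj : Set.InjOn (fun (c : List (Literal φ.n)) (i : Fin k) => getElem? c (i : ℕ))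
      {c | c.length ≤ k} := by
    intro c hc c' hc' h
    refine List.ext_getElem? fun i => ?_
    by_cases hi : i < k
    · exact congrFun h ⟨i, hi⟩
    · have hc : c.length ≤ k := hc
      have hc' : c'.length ≤ k := hc'
      rw [List.getElem?_eq_none (by omega), List.getElem?_eq_none (by omega)]
  have h1 : (φ.clauses.map fun c (i : Fin k) => getElem? c (i : ℕ)).Nodup :=
    List.Nodup.map_on (fun c hc c' hc' => hinj (φ.length_le c hc) (φ.length_le c' hc')) φ.nodup
  have h2 := h1.length_le_card
  rw [List.length_map] at h2
  refine h2.trans_eq ?_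
  simp [Literal, mul_comm]

theorem cost_pow_le {V W z : ℕ} (h : V ≤ 2 ^ W) : cost (V ^ z) ≤ W * z + 2 := by
  have h1 : V ^ z < 2 ^ (W * z + 1) := by
    rw [pow_succ, pow_mul]
    have := Nat.pow_le_pow_left h z
    have : 0 < (2 ^ W) ^ z := by positivity
    omega
  have := Nat.size_le.2 h1
  unfold cost
  omega

/-- For fixed `k` and polynomially many clauses the exponent is polynomial in `n`, so a tick costs
only polynomial time although whole formulas are handled as single numbers. -/
theorem sizeBound_le (n M k : ℕ) :
    sizeBound n M k ≤ 2 ^ (n + 7 + (4 * n + 1) * (M * (k + 1) + 1) + (M * (k + 1) + 1)) := by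
  have h1 : n + 1 ≤ 2 ^ n := Nat.lt_two_pow_self
  have h2 : M * (k + 1) + 1 ≤ 2 ^ (M * (k + 1) + 1) := Nat.lt_two_pow_self.le
  have h3 : base ((n + 1) / 2) ≤ 2 ^ (4 * n + 1) := by
    rw [base_eq]
    exact Nat.pow_le_pow_right (by norm_num) (by omega)
  unfold sizeBound
  refine (Nat.mul_le_mul h1 (Nat.mul_le_mul (show 100 ≤ 2 ^ 7 by norm_num)
    (Nat.mul_le_mul (Nat.pow_le_pow_left h3 _) h2))).trans_eq ?_
  rw [← pow_mul, ← pow_add, ← pow_add, ← pow_add]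
  congr 1
  ring

/-- The time that the reduction takes in addition to the time of the subroutine. -/
theorem overhead_le (k : ℕ) : ∃ f, PolyBounded f ∧ ∀ n M, M ≤ (2 * n + 1) ^ k →
    overhead ((n + 1) / 2) M k * tick (sizeBound n M k) ≤ 2 ^ ((n + 1) / 2) * f n := by
  have c := PolyBounded.const
  have hn := PolyBounded.id
  have hM : PolyBounded fun n => (2 * n + 1) ^ k := (((c 2).mul hn).add (c 1)).pow k
  have hX := hM.mul (c (k + 1))
  -- `f` is read off from this term: it is `overhead` without the factor `2 ^ h`, times `tick`, with
  -- the number of clauses replaced by its bound and `h` by `n`. The summand `9` covers the `4 * 2 ^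
  -- h + 5` ticks of `scan`.
  refine ⟨_, ((((c 2).mul ((hX.mul (c 25)).add (c 30))).add (((c 48).mul hM).add
    ((c 29).add (((hM.mul (((c k).mul (((c 6).mul hn).add (c 17))).add (c 7))).add
      (((c 3).mul hn).add (c 13))))))).add (c 9)).mul
    ((c 200).mul (((((hn.add (c 7)).add ((((c 4).mul hn).add (c 1)).mul (hX.add (c 1)))).add
      (hX.add (c 1))).mul (c 24)).add (c 2))), fun n M hMn => ?_⟩
  have hMX : M * (k + 1) ≤ (2 * n + 1) ^ k * (k + 1) := Nat.mul_le_mul_right _ hMn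
  generalize (2 * n + 1) ^ k = M' at *
  have hh : (n + 1) / 2 ≤ n := by omega
  rw [← mul_assoc]
  refine Nat.mul_le_mul ?_ ?_
  · unfold overhead
    have h1 := Nat.one_le_two_pow (n := (n + 1) / 2)
    generalize (n + 1) / 2 = h at *
    generalize 2 ^ h = N at *
    have h2 : M * (k * (6 * h + 17) + 7) ≤ M' * (k * (6 * n + 17) + 7) := by gcongr
    have h3 : 2 * N * (M * (k + 1) * 25 + 30) ≤ N * (2 * (M' * (k + 1) * 25 + 30)) := by
      calc _ ≤ 2 * N * (M' * (k + 1) * 25 + 30) := by gcongr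
        _ = _ := by ring
    have h4 : ∀ z, z ≤ N * z := fun z => Nat.le_mul_of_pos_left z h1
    have h5 := h4 (48 * M' + (29 + (M' * (k * (6 * n + 17) + 7) + (3 * n + 13))))
    have h6 : ∀ a b, N * (a + b + 9) = N * a + N * b + N * 9 := fun a b => by ring
    rw [h6]
    omega
  · unfold tick
    refine Nat.mul_le_mul_left _ ((cost_pow_le (sizeBound_le n M k)).trans ?_)
    gcongr

/-! ### From eccentricities to `k`-SAT -/

theorem encode_eq {k : ℕ} (φ : KCNF k) :
    φ.encode = φ.n :: (codes φ).length :: clauseCells (codes φ) := by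
  simp [KCNF.encode, codes, clauseCells, List.flatMap_map]

theorem codes_bounds {k : ℕ} (φ : KCNF k) :
    ∀ c ∈ codes φ, c.length ≤ k ∧ ∀ l ∈ c, l < 2 * φ.n := by
  intro c hc
  simp only [codes, List.mem_map] at hc
  obtain ⟨c, hc, rfl⟩ := hc
  refine ⟨by simpa using φ.length_le c hc, fun l hl => ?_⟩
  rw [List.mem_map] at hl
  obtain ⟨l, _, rfl⟩ := hl
  have := encodeLiteral_div l
  omega

theorem edgeList_reductionGraph {N : ℕ} (hN : 1 ≤ N) {Ds : List (List ℕ)}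
    (hDs : ∀ l ∈ Ds, ∀ d ∈ l, 1 < d) :
    EdgeList (2 * N + 3 * Ds.length + 2) (graphEdges N Ds.length (allDigits Ds)) where
  two_le := by omega
  lt _ he := graphEdges_lt hDs rfl he
  nodup := nodup_graphEdges hDs rfl
  connected := reductionGraph_connected hDs

/-- The reduction decides satisfiability. -/
theorem reduction_correct {dir wt : Bool} {p : Cmd} {g : ℕ → ℕ → ℝ} (hp : ComputesEcc dir wt p g)
    {k : ℕ} (φ : KCNF k) {h M : ℕ} (hh : h = (φ.n + 1) / 2) (hM : M = φ.clauses.length) :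
    ∃ t s, Exec (reduction dir wt p) (init φ.encode) t s ∧ φ.Correct s.mem ∧
      (t : ℝ) ≤ g ((2 * 2 ^ h * (M + 1) + 3 * M + 1) * if dir then 2 else 1)
        (2 * 2 ^ h + 3 * M + 2) + (overhead h M k * tick (sizeBound φ.n M k) : ℕ) := by
  have hDs : ∀ l ∈ literalDigits h (codes φ), ∀ d ∈ l, 1 < d := one_lt_of_mem_literalDigits
  have hlen : (literalDigits h (codes φ)).length = M := by simp [literalDigits, codes, hM]
  have hlen' : (codes φ).length = M := by simp [codes, hM]
  have hN : 1 ≤ 2 ^ h := Nat.one_le_two_pow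
  obtain ⟨t, s, h1, h2, h3⟩ := hp _ _ (edgeList_reductionGraph hN hDs)
  have hcells : EdgeList.cells dir wt (2 * 2 ^ h + 3 * (literalDigits h (codes φ)).length + 2)
      (graphEdges (2 ^ h) (literalDigits h (codes φ)).length
        (allDigits (literalDigits h (codes φ)))) =
      graphCells dir wt (2 ^ h) (codes φ).length (pushClauses h (codes φ) []) := by
    rw [EdgeList.cells, graphCells, length_graphEdges hDs rfl, hlen, hlen',
      pushClauses_eq_allDigits]
  rw [hcells] at h1
  have hecc : ∀ y (hy : y < 2 ^ h), (s.mem (2 ^ h + y) : ℕ∞) =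
      (reductionGraph (2 ^ h) (literalDigits h (codes φ))).eccent ⟨2 ^ h + y, by omega⟩ :=
    fun y hy => h2 ⟨2 ^ h + y, by omega⟩
  have hmem : ∀ y < 2 ^ h, s.mem (2 ^ h + y) = 2 ∨ s.mem (2 ^ h + y) = 3 := by
    intro y hy
    have := (eccent_reductionGraph hDs hy).1
    rw [← hecc y hy] at this
    exact_mod_cast this
  have hsat : φ.Satisfiable ↔ ∃ y < 2 ^ h, s.mem (2 ^ h + y) = 3 := by
    rw [satisfiable_iff φ (show φ.n ≤ 2 * h by omega)]
    have key : ∀ y < 2 ^ h, (s.mem (2 ^ h + y) = 3 ↔ ∃ x < 2 ^ h, ∀ c ∈ codes φ,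
        Hit (mask (2 ^ h) x) (c.map (litDigit h)).reverse ∨
        Hit (mask (2 ^ h) (2 ^ h + y)) (c.map (litDigit h)).reverse) := by
      intro y hy
      have := (eccent_reductionGraph hDs hy).2
      rw [← hecc y hy] at this
      have e : ((s.mem (2 ^ h + y) : ℕ∞) = 3) ↔ s.mem (2 ^ h + y) = 3 := by norm_cast
      rw [← e, this]
      refine exists_congr fun x => and_congr_right fun _ => ?_
      exact forall_getD_literalDigits (P := fun l => Hit (mask (2 ^ h) x) l ∨
        Hit (mask (2 ^ h) (2 ^ h + y)) l)
    constructor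
    · rintro ⟨x, hx, y, hy, hxy⟩
      exact ⟨y, hy, (key y hy).2 ⟨x, hx, hxy⟩⟩
    · rintro ⟨y, hy, hy3⟩
      obtain ⟨x, hx, hxy⟩ := (key y hy).1 hy3
      exact ⟨x, hx, y, hy, hxy⟩
  obtain ⟨t', s', e, ht', c1, c2⟩ := reduction_exec dir wt hh (codes_bounds φ) h1 hmem
  rw [← encode_eq] at e
  refine ⟨t', s', e, ⟨fun hs => c1 (hsat.1 hs), fun hs => c2 fun h => hs (hsat.2 h)⟩, ?_⟩
  rw [length_graphEdges hDs rfl, hlen] at h3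
  rw [hlen'] at ht'
  have : (t' : ℝ) ≤ t + (overhead h M k * tick (sizeBound φ.n M k) : ℕ) := by exact_mod_cast ht'
  linarith

/-- `N` is about `2 ^ (n / 2)`, so `N ^ γ` with `γ < 2` is about `2 ^ (γ n / 2)`. Polynomial factors
fit into the gap between `γ / 2` and `1`; `k` affects only those factors, so `δ` is chosen before
`k`. -/
theorem kSatInTime_of_computesEcc {dir wt : Bool} {p : Cmd} {g : ℕ → ℕ → ℝ} (hg : IsSubMN g)
    (hp : ComputesEcc dir wt p g) : ∃ δ < (1 : ℝ), ∀ k, KSatInTime k δ := by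
  obtain ⟨α, β, C, hαβ, hC⟩ := hg
  -- `1 ≤ γ` is imposed so that `N ^ γ` also dominates the time `N · poly(n)` for building the
  -- graph.
  obtain ⟨γ, hγ, hγ1, hγ2⟩ : ∃ γ : ℝ, α + β ≤ γ ∧ 1 ≤ γ ∧ γ < 2 :=
    ⟨max (α + β) 1, le_max_left _ _, le_max_right _ _, max_lt hαβ (by norm_num)⟩
  -- `δ` is the midpoint of `γ / 2` and `1`.
  refine ⟨γ / 2 + (1 - γ / 2) / 2, by linarith, fun k => ?_⟩
  obtain ⟨f, hf, hov⟩ := overhead_le k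
  obtain ⟨D, hD⟩ := exists_nat_ge (|α| + |β|)
  have c := PolyBounded.const
  -- In the directed case the number of arcs is `2 (2 N (M + 1) + 3 M + 1) ≤ N (10 M + 6)`, whence
  -- `10` and `6`; the number of vertices is smaller than this bound.
  have hq : PolyBounded fun n => (10 * (2 * n + 1) ^ k + 6) ^ D :=
    (((c 10).mul ((((c 2).mul .id).add (c 1)).pow k)).add (c 6)).pow D
  have hε : 0 < (1 - γ / 2) / 2 := by linarith
  obtain ⟨C₁, hC₁, h1⟩ := hf.le_two_rpow hε
  obtain ⟨C₂, hC₂, h2⟩ := hq.le_two_rpow hε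
  refine ⟨reduction dir wt p, 2 * (|C| * C₂ + C₁), fun φ => ?_⟩
  obtain ⟨t, s, e, hcor, ht⟩ := reduction_correct hp φ rfl rfl
  refine ⟨t, s, e, hcor, ht.trans ?_⟩
  have hM := length_clauses_le φ
  have hov := hov φ.n _ hM
  have h1 := h1 φ.n
  have h2 := h2 φ.n
  generalize φ.clauses.length = M at *
  generalize hE : ((2 * 2 ^ ((φ.n + 1) / 2) * (M + 1) + 3 * M + 1) * if dir then 2 else 1) = m
  obtain ⟨N, hN⟩ : ∃ N, N = 2 ^ ((φ.n + 1) / 2) := ⟨_, rfl⟩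
  have hN1 : 1 ≤ N := hN ▸ Nat.one_le_two_pow
  rw [← hN] at hov hE ⊢
  have hm1 : 2 * N * (M + 1) + 3 * M + 1 ≤ m := by rw [← hE]; split_ifs <;> omega
  have hm2 : m ≤ (2 * N * (M + 1) + 3 * M + 1) * 2 := by rw [← hE]; split_ifs <;> omega
  have hNM : N * (10 * M + 6) ≤ N * (10 * (2 * φ.n + 1) ^ k + 6) :=
    Nat.mul_le_mul_left _ (by omega)
  have hNM1 : 1 * M ≤ N * M := Nat.mul_le_mul_right _ hN1
  have hexp1 : N * (10 * M + 6) = 10 * (N * M) + 6 * N := by ring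
  have hexp2 : 2 * N * (M + 1) = 2 * (N * M) + 2 * N := by ring
  have hg := (hC m (2 * N + 3 * M + 2) (by omega) (by omega)).trans
    (subMN_le (C := C) hγ (q := 10 * (2 * φ.n + 1) ^ k + 6) hD hN1 (by omega) (by omega)
      (by omega) (by omega))
  have hN1' : (1 : ℝ) ≤ N := by exact_mod_cast hN1
  have hNγ : (N : ℝ) ≤ (N : ℝ) ^ γ := Real.self_le_rpow_of_one_le hN1' hγ1
  -- The factor `2` pays for rounding `n / 2` up, since `γ / 2 ≤ 1`.
  have hNγ2 : (N : ℝ) ^ γ ≤ 2 * 2 ^ (γ / 2 * φ.n) := by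
    have hh : (((φ.n + 1) / 2 : ℕ) : ℝ) ≤ ((φ.n : ℝ) + 1) / 2 := by
      simpa using Nat.cast_div_le (α := ℝ) (m := φ.n + 1) (n := 2)
    have hmul := mul_le_mul_of_nonneg_right hh (show 0 ≤ γ by linarith)
    rw [hN, Nat.cast_pow, Nat.cast_ofNat, ← Real.rpow_natCast, ← Real.rpow_mul two_pos.le]
    refine (Real.rpow_le_rpow_of_exponent_le one_le_two (?_ : _ ≤ 1 + γ / 2 * φ.n)).trans_eq ?_
    · linarith
    · rw [Real.rpow_add two_pos, Real.rpow_one]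
  have hov' : ((overhead ((φ.n + 1) / 2) M k * tick (sizeBound φ.n M k) : ℕ) : ℝ) ≤ N * f φ.n := by
    exact_mod_cast hov
  push_cast at h2 hg
  refine (add_le_add hg hov').trans ?_
  show _ ≤ 2 * (|C| * C₂ + C₁) * (2 : ℝ) ^ ((γ / 2 + (1 - γ / 2) / 2) * φ.n)
  rw [add_mul (γ / 2), Real.rpow_add two_pos]
  have hA : (0 : ℝ) ≤ 2 * 2 ^ (γ / 2 * φ.n) := by positivity
  have b1 := mul_le_mul_of_nonneg_left (mul_le_mul hNγ2 h2 (by positivity) hA) (abs_nonneg C)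
  have b2 := mul_le_mul (hNγ.trans hNγ2) h1 (Nat.cast_nonneg _) hA
  refine (add_le_add b1 b2).trans_eq ?_
  ring

end RAM

/-! ### Conclusion: the four hardness statements -/

theorem mainTheorem6 (hSETH : SETH) :
    ¬ HasSubMNAlgorithm eccUndirected ∧
    ¬ HasSubMNAlgorithm eccDirected ∧
    (∀ a : ℕ, ¬ HasSubMNAlgorithm (eccWeightedUndirected a)) ∧
    (∀ a : ℕ, ¬ HasSubMNAlgorithm (eccWeightedDirected a)) := by
  have key : ∀ {dir wt p g}, IsSubMN g → ¬ RAM.ComputesEcc dir wt p g := by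
    intro dir wt p g hg hp
    obtain ⟨δ, hδ, h⟩ := RAM.kSatInTime_of_computesEcc hg hp
    obtain ⟨k, hk⟩ := hSETH δ hδ
    exact hk (h k)
  refine ⟨?_, ?_, fun a => ?_, fun a => ?_⟩ <;> rintro ⟨p, g, hg, h⟩
  · exact key hg (RAM.computesEcc_undirected h)
  · exact key hg (RAM.computesEcc_directed h)
  · exact key hg (RAM.computesEcc_weightedUndirected h)
  · exact key hg (RAM.computesEcc_weightedDirected h)
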